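/- Let $E=\mathbb C/2\pi i\mathbb Z$, let $\mathrm{Re}:E\to\mathbb R$ be the real part map, let $\log:\mathbb C^\times\to E$ be the complex logarithm (the inverse of $\exp:E\to\mathbb C^\times$), and let $\mathrm{Leb}_E$ be the Haar measure $dx'\,dy'$ on $E$, where $x'+iy'\in E$ with $x'\in\mathbb R$, $y'\in\mathbb R/2\pi\mathbb Z$. Let $C_c^1(E)$ be the space of compactly supported complex-valued functions on $E$ of class $C^1$ in the real sense. Let $K\subset\mathbb C$ be an imaginary quadratic number field whose ring of integers $\mathcal O_K$ is principal. Let $\Lambda$ be a nonzero ideal of $\mathcal O_K$, let $\mathbf N$ denote the norm of ideals, and put $\varphi_K(a)=\mathrm{Card}\big((\mathcal O_K/a\mathcal O_K)^\times\big)$ for $a\in\mathcal O_K\setminus\{0\}$ and $c_\Lambda=\mathbf N(\Lambda)\prod_{\mathfrak p\mid\Lambda}\big(1+\frac1{\mathbf N(\mathfrak p)}\big)$, where $\mathfrak p$ ranges over the prime ideals of $\mathcal O_K$ dividing $\Lambda$. For $N\in\mathbb N\setminus\{0\}$ let $$\tilde\nu_N=\sum_{\substack{m,n\in\Lambda,\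 m\ne n\\ 0<|m|,|n|\le N}}\varphi_K(m)\,\varphi_K(n)\,\Delta_{\log m-\log n},$$ a finitely supported measure on $E$, where $\Delta_z$ is the unit Dirac mass at $z$; let $\|\tilde\nu_N\|$ be its total mass. **Theorem.** (1) For all $N$ large enough, $\tilde\nu_N/\|\tilde\nu_N\|$ is a probability measure, and as $N\to+\infty$ these measures weak-star converge (that is, against every compactly supported continuous function $E\to\mathbb C$) to the probability measure $\frac1\pi e^{-4|\mathrm{Re}\,z'|}\,d\mathrm{Leb}_E(z')$, which is independent of $\Lambda$ and $K$. (2) There is an absolute constant $C>0$ such that for all $K$ and $\Lambda$ as above, all $f\in C_c^1(E)$ and all $\alpha\in\,]0,\frac12[$, there exists $N_0$ (possibly depending on $K$, $\Lambda$, $f$ and $\alpha$) such that for all integers $N\ge N_0$, $$\left|\frac{\tilde\nu_N}{\|\tilde\nu_N\|}(f)-\int_{E}\frac1\pi e^{-4|\mathrm{Re}\,z'|}f(z')\,d\mathrm{Leb}_E(z')\right|\le C\left(\frac{c_\Lambda\|f\|_\infty}{N^{1-2\alpha}}+\frac{\|e^{z'}df(z')\|_\infty}{N^{\alpha}}\right),$$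 where $\|f\|_\infty=\sup_{z'\in E}|f(z')|$ and $\|e^{z'}df(z')\|_\infty=\sup_{z'\in E}|e^{z'}|\,\|df(z')\|$, with $\|df(z')\|$ the operator norm of the real differential of $f$ at $z'$. -/

import Mathlib

open MeasureTheory Filter Topology
open scoped ENNReal NumberField

noncomputable section

namespace EulerPairCorrelation

/-! ### The cylinder `E = ℂ / 2πiℤ` -/

/-- The cylinder `E = ℂ / 2πiℤ`, with its quotient group structure, quotient topology and the
quotient σ-algebra (which is the Borel σ-algebra, see `borelSpace_cylinder` below). -/
abbrev Cylinder : Type := ℂ ⧸ AddSubgroup.zmultiples (2 * (Real.pi : ℂ) * Complex.I)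

theorem isClosed_periods :
    IsClosed ((AddSubgroup.zmultiples (2 * (Real.pi : ℂ) * Complex.I) : AddSubgroup ℂ) : Set ℂ) := by
  have h : ((AddSubgroup.zmultiples (2 * (Real.pi : ℂ) * Complex.I) : AddSubgroup ℂ) : Set ℂ)
      = Complex.exp ⁻¹' {1} := by
    ext z
    simp only [SetLike.mem_coe, AddSubgroup.mem_zmultiples_iff, Set.mem_preimage,
      Set.mem_singleton_iff, Complex.exp_eq_one_iff, zsmul_eq_mul]
    exact ⟨fun ⟨k, hk⟩ => ⟨k, hk.symm⟩, fun ⟨k, hk⟩ => ⟨k, hk.symm⟩⟩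
  rw [h]
  exact isClosed_singleton.preimage Complex.continuous_exp

instance isClosed_periods_inst :
    IsClosed ((AddSubgroup.zmultiples (2 * (Real.pi : ℂ) * Complex.I) : AddSubgroup ℂ) : Set ℂ) :=
  isClosed_periods

instance borelSpace_cylinder : BorelSpace Cylinder := inferInstance

/-- The quotient map `ℂ → E`. -/
def toCylinder (z : ℂ) : Cylinder := QuotientAddGroup.mk z

/-- The real part `Re : E → ℝ`, `x' + iy' mod 2πi ↦ x'`. -/
def cylRe : Cylinder →+ ℝ :=
  QuotientAddGroup.lift _ Complex.reAddGroupHom (by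
    intro z hz
    obtain ⟨k, rfl⟩ := AddSubgroup.mem_zmultiples_iff.mp hz
    simp)

/-- The Haar measure `dLeb_E(x' + iy') = dx' dy'` on `E`, with `x' ∈ ℝ` and `y' ∈ ℝ / 2πℤ`: the
image of the Lebesgue measure of the strip `-π < Im z ≤ π`, a fundamental domain for `2πiℤ`. -/
def lebCylinder : Measure Cylinder :=
  ((volume : Measure ℂ).restrict {z : ℂ | z.im ∈ Set.Ioc (-Real.pi) Real.pi}).map toCylinder

/-- The complex logarithm with values in `E` (the group isomorphism `ℂˣ → E` inverse to the
exponential map); only its values at nonzero complex numbers matter. -/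
def cylLog (z : ℂ) : Cylinder := toCylinder (Complex.log z)

/-- `f : E → ℂ` is of class `C¹` (for the real differentiable structure of `E`, for which `ℂ → E`
is a local diffeomorphism) and compactly supported. -/
def IsCompactlySupportedC1 (f : Cylinder → ℂ) : Prop :=
  ContDiff ℝ 1 (fun z : ℂ => f (toCylinder z)) ∧ HasCompactSupport f

/-- The uniform norm `‖f‖_∞`. -/
def supNorm (f : Cylinder → ℂ) : ℝ := ⨆ z : Cylinder, ‖f z‖

/-- The uniform norm `‖e^{z'} df(z')‖_∞`, where `df` is the real differential of `f`; it is computed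
on the universal cover `ℂ → E`, a local isometry. -/
def expDiffSupNorm (f : Cylinder → ℂ) : ℝ :=
  ⨆ z : ℂ, ‖Complex.exp z • fderiv ℝ (fun w : ℂ => f (toCylinder w)) z‖

/-- The function `z' ↦ (1/π) e^{-4 |Re z'|}` on `E`. -/
def pairCorrelationFunction (z : Cylinder) : ℝ :=
  (1 / Real.pi) * Real.exp (-4 * |cylRe z|)

/-- The measure on `E` with density `pairCorrelationFunction` with respect to `Leb_E`. -/
def limitMeasure : Measure Cylinder :=
  lebCylinder.withDensity (fun z => ENNReal.ofReal (pairCorrelationFunction z))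

/-! ### The arithmetic weights and the pair correlation measures -/

variable {K : Type*} [Field K]

/-- The Euler function `φ_K(a) = Card((𝓞_K / a 𝓞_K)ˣ)`, for `a ∈ 𝓞_K` nonzero. -/
def eulerPhi (a : 𝓞 K) : ℕ := Nat.card (𝓞 K ⧸ Ideal.span {a})ˣ

/-- The index set `I_N` of the pairs `(m, n) ∈ Λ²` with `0 < |m|, |n| ≤ N` and `m ≠ n`, where `K`
is seen as a subfield of `ℂ` by the embedding `σ`. -/
def pairIndex (σ : K →+* ℂ) (Λ : Ideal (𝓞 K)) (N : ℕ) : Set (𝓞 K × 𝓞 K) :=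
  {p | p.1 ∈ Λ ∧ p.2 ∈ Λ ∧ 0 < ‖σ p.1‖ ∧ ‖σ p.1‖ ≤ N ∧ 0 < ‖σ p.2‖ ∧ ‖σ p.2‖ ≤ N ∧ p.1 ≠ p.2}

/-- The pair correlation measure `ν_N = ∑_{(m, n) ∈ I_N} φ_K(m) φ_K(n) Δ_{log m - log n}` on `E`. -/
def pairMeasure (σ : K →+* ℂ) (Λ : Ideal (𝓞 K)) (N : ℕ) : Measure Cylinder :=
  Measure.sum fun p : pairIndex σ Λ N =>
    ((eulerPhi p.1.1 * eulerPhi p.1.2 : ℕ) : ℝ≥0∞) •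
      Measure.dirac (cylLog (σ p.1.1) - cylLog (σ p.1.2))

/-- The measure `ν_N / ‖ν_N‖`, where `‖ν_N‖` is the total mass of `ν_N`. -/
def normalizedPairMeasure (σ : K →+* ℂ) (Λ : Ideal (𝓞 K)) (N : ℕ) : Measure Cylinder :=
  (pairMeasure σ Λ N Set.univ)⁻¹ • pairMeasure σ Λ N

/-- The constant `c_Λ = N(Λ) ∏_{𝔭 ∣ Λ} (1 + 1 / N(𝔭))` of a nonzero ideal `Λ`, where `𝔭` ranges over
the (nonzero) prime ideals dividing `Λ`. -/
def idealConst [NumberField K] (Λ : Ideal (𝓞 K)) : ℝ :=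
  (Ideal.absNorm Λ : ℝ) *
    ∏ᶠ (𝔭 : IsDedekindDomain.HeightOneSpectrum (𝓞 K)) (_ : 𝔭.asIdeal ∣ Λ),
      (1 + 1 / (Ideal.absNorm 𝔭.asIdeal : ℝ))

end EulerPairCorrelation

end

/-! Since `K` has a single infinite place, `‖σ x‖ ^ 2` is the norm of `x`, and `σ(𝓞 K)` is a lattice
in `ℂ`. By inclusion-exclusion, `φ_K(m)` is `‖σ m‖ ^ 2` times the sum, over finite sets `T` of
primes containing `m`, of `∏ v ∈ T, -1 / N(v)`. Summing over `m ∈ Λ` and exchanging the two sums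
leaves, for each `T`, a sum of `|z|² g(z)` over the lattice of `Λ ⊓ primeInf T`. This ideal is
principal, so its lattice is `a_T · σ(𝓞 K)`, and comparison with an integral costs `O(N³ / ‖a_T‖)`
for Lipschitz `g` at scale `N`. The errors can be summed because weight times `1 / ‖a_T‖` is at most
`∏ v ∈ T, N(v)^(-3/2)`, a summable family. Hence `∑ φ_K(m) g(σ m) = c ∫_{|z| ≤ N} |z|² g(z) dz +
error` with `c > 0` (`exists_totient_sum_bound`).

Applying this to each variable of the pair sum (`exists_pair_sum_bound`) gives the main term `c² ∫∫
|w|² |z|² g(z / w)`. The substitution `z = w u` and integration over `w` turn it into `c² (π / 4) N⁸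
∫ |u|² min(1, 1/|u|)⁸ g(u) du`, and `u = exp z'` produces the density `e^{-4|Re z'|}`
(`quotientIntegral_pullbackLog`). The diagonal is `O(N⁶)`, and the total mass is `c² (π² / 4) N⁸ +
O(N⁷)`, so `c`, the only trace of `K` and `Λ`, cancels (`exists_equidistribution_bound`).

For a `C¹` function the error is `O(1 / N)`, with a constant depending on `K`, `Λ` and `f`. Since
`N₀` may depend on these too and `1 / N` is smaller than `N^{-(1 - 2α)}` by a power of `N`, the
stated rate follows (`exists_rate`). Merely continuous functions are Lipschitz up to an error `ε`,
and `IsApproxLip` treats both cases together. -/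

noncomputable section

namespace EulerPairCorrelation

open IsDedekindDomain

/-! ### The ring of integers as a lattice in the plane -/

section Lattice

variable {K : Type*} [Field K]

/-- The additive map `𝓞 K → ℂ` induced by `σ`, as a `ℤ`-linear map. -/
def integerEmbedding (σ : K →+* ℂ) : 𝓞 K →ₗ[ℤ] ℂ :=
  (σ.comp (algebraMap (𝓞 K) K)).toAddMonoidHom.toIntLinearMap

@[simp] theorem integerEmbedding_apply (σ : K →+* ℂ) (x : 𝓞 K) :
    integerEmbedding σ x = σ x := rfl

theorem integerEmbedding_injective (σ : K →+* ℂ) :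
    Function.Injective (integerEmbedding σ) := fun a b h => by
  simp only [integerEmbedding_apply] at h
  exact NumberField.RingOfIntegers.ext (σ.injective h)

variable [NumberField K] [NumberField.IsTotallyComplex K]

/-- From `r₁ + 2 r₂ = 2` and `r₁ = 0` there is only one infinite place, which all embeddings define.
-/
theorem norm_embedding_eq (h2 : Module.finrank ℚ K = 2) (φ σ : K →+* ℂ) (x : K) :
    ‖φ x‖ = ‖σ x‖ := by
  classical
  have h := NumberField.InfinitePlace.card_add_two_mul_card_eq_rank K
  have h0 : NumberField.InfinitePlace.nrRealPlaces K = 0 :=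
    NumberField.nrRealPlaces_eq_zero_iff.mpr inferInstance
  have hc : Fintype.card (NumberField.InfinitePlace K) = 1 := by
    rw [NumberField.InfinitePlace.card_eq_nrRealPlaces_add_nrComplexPlaces]
    omega
  have : Subsingleton (NumberField.InfinitePlace K) :=
    Fintype.card_le_one_iff_subsingleton.mp hc.le
  have e : NumberField.InfinitePlace.mk φ = NumberField.InfinitePlace.mk σ :=
    Subsingleton.elim _ _
  have := congrArg (fun w : NumberField.InfinitePlace K => w x) e
  simpa [NumberField.InfinitePlace.apply] using this

theorem norm_sq_eq_absNorm (h2 : Module.finrank ℚ K = 2) (σ : K →+* ℂ) (x : 𝓞 K) :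
    ‖σ x‖ ^ 2 = (Ideal.absNorm (Ideal.span {x}) : ℝ) := by
  have h := Algebra.norm_eq_prod_embeddings ℚ ℂ (x : K)
  have h' := congrArg norm h
  rw [norm_prod] at h'
  rw [Ideal.absNorm_span_singleton]
  have hcard : Fintype.card (K →ₐ[ℚ] ℂ) = 2 := by
    rw [AlgHom.card, h2]
  have hφ (φ : K →ₐ[ℚ] ℂ) : ‖φ (x : K)‖ = ‖σ (x : K)‖ :=
    norm_embedding_eq h2 (φ : K →+* ℂ) σ (x : K)
  simp only [hφ] at h'
  rw [Finset.prod_const, Finset.card_univ, hcard] at h'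
  rw [← h', ← Algebra.coe_norm_int]
  simp [Nat.cast_natAbs]

theorem finite_norm_le (h2 : Module.finrank ℚ K = 2) (σ : K →+* ℂ) (R : ℝ) :
    {x : 𝓞 K | ‖σ x‖ ≤ R}.Finite := by
  have h := NumberField.Embeddings.finite_of_norm_le K ℂ R
  refine Set.Finite.of_finite_image (f := fun x : 𝓞 K => (x : K)) (h.subset ?_)
    (fun a _ b _ hab => NumberField.RingOfIntegers.ext hab)
  rintro _ ⟨x, hx, rfl⟩
  exact ⟨x.isIntegral_coe, fun φ => (norm_embedding_eq h2 φ σ x).trans_le hx⟩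

/-- The square is a positive integer. This gives discreteness of the lattice, and shows that a disc
of radius less than `1` contains no nonzero lattice point. -/
theorem one_le_norm (h2 : Module.finrank ℚ K = 2) (σ : K →+* ℂ) {x : 𝓞 K} (hx : x ≠ 0) :
    1 ≤ ‖σ x‖ := by
  have h := norm_sq_eq_absNorm h2 σ x
  have : (1 : ℝ) ≤ (Ideal.absNorm (Ideal.span {x}) : ℝ) := by
    have : Ideal.absNorm (Ideal.span {x}) ≠ 0 := by
      rw [Ne, Ideal.absNorm_eq_zero_iff, Ideal.span_singleton_eq_bot]; exact hx
    exact_mod_cast Nat.one_le_iff_ne_zero.mpr this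
  rw [← h] at this
  by_contra hlt
  push Not at hlt
  nlinarith [norm_nonneg (σ x)]

theorem discreteTopology_range (h2 : Module.finrank ℚ K = 2) (σ : K →+* ℂ) :
    DiscreteTopology (LinearMap.range (integerEmbedding σ)) := by
  refine discreteTopology_of_isOpen_singleton_zero ?_
  refine ⟨Metric.ball 0 1, Metric.isOpen_ball, ?_⟩
  ext ⟨z, hz⟩
  obtain ⟨x, rfl⟩ := hz
  simp only [Set.mem_preimage, Metric.mem_ball, dist_zero_right, Set.mem_singleton_iff,
    integerEmbedding_apply]
  constructor
  · intro h
    by_contra hne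
    have : x ≠ 0 := by rintro rfl; apply hne; ext; simp
    linarith [one_le_norm h2 σ this]
  · intro h
    have := congrArg Subtype.val h
    simp only at this
    rw [this]; simp

/-- If all integers had real image, so would their quotients, and `σ` would define a real place. -/
theorem exists_im_ne_zero (σ : K →+* ℂ) : ∃ x : 𝓞 K, (σ x).im ≠ 0 := by
  by_contra! h
  have hr : NumberField.ComplexEmbedding.IsReal σ := by
    rw [NumberField.ComplexEmbedding.isReal_iff]
    ext y
    obtain ⟨a, b, hb, rfl⟩ := IsFractionRing.div_surjective (A := 𝓞 K) y
    rw [NumberField.ComplexEmbedding.conjugate_coe_eq, map_div₀, map_div₀,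
      Complex.conj_eq_iff_im.mpr (h a), Complex.conj_eq_iff_im.mpr (h b)]
  exact NumberField.InfinitePlace.not_isReal_iff_isComplex.mpr
    (NumberField.IsTotallyComplex.isComplex (NumberField.InfinitePlace.mk σ))
    ⟨σ, hr, rfl⟩

theorem isZLattice_range (h2 : Module.finrank ℚ K = 2) (σ : K →+* ℂ) :
    have := discreteTopology_range h2 σ
    IsZLattice ℝ (LinearMap.range (integerEmbedding σ)) := by
  have := discreteTopology_range h2 σ
  refine ⟨?_⟩
  obtain ⟨x, hx⟩ := exists_im_ne_zero σ
  rw [eq_top_iff]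
  intro z _
  have e : z = (z.re - z.im / (σ x).im * (σ x).re) • (1 : ℂ) + (z.im / (σ x).im) • σ x := by
    apply Complex.ext
    · simp
    · simp; field_simp
  rw [e]
  refine Submodule.add_mem _ (Submodule.smul_mem _ _ (Submodule.subset_span ⟨1, by simp⟩))
    (Submodule.smul_mem _ _ (Submodule.subset_span ⟨x, rfl⟩))

/-- A bounded set `P ⊂ ℂ` of positive area such that integrals over `ℂ` decompose along the
translates of `P` by `σ(𝓞 K)`. -/
structure IsCell (σ : K →+* ℂ) (P : Set ℂ) (D : ℝ) : Prop where
  pos : 0 < D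
  measurableSet : MeasurableSet P
  norm_le : ∀ z ∈ P, ‖z‖ ≤ D
  area_pos : 0 < volume.real P
  hasSum : ∀ {F : Type} [NormedAddCommGroup F] [NormedSpace ℝ F] (f : ℂ → F), Integrable f →
    HasSum (fun x : 𝓞 K => ∫ u in P, f (σ x + u)) (∫ z, f z)

/-- The half-open parallelotope of a `ℤ`-basis works: integer and fractional parts show that its
translates cover the plane and are disjoint. -/
theorem exists_isCell (h2 : Module.finrank ℚ K = 2) (σ : K →+* ℂ) :
    ∃ (P : Set ℂ) (D : ℝ), IsCell σ P D := by
  have := discreteTopology_range h2 σ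
  have := isZLattice_range h2 σ
  have := ZLattice.module_free ℝ (LinearMap.range (integerEmbedding σ))
  have := ZLattice.module_finite ℝ (LinearMap.range (integerEmbedding σ))
  let b := (Module.Free.chooseBasis ℤ (LinearMap.range (integerEmbedding σ))).ofZLatticeBasis ℝ
  have hspan : Submodule.span ℤ (Set.range b) = LinearMap.range (integerEmbedding σ) :=
    Module.Basis.ofZLatticeBasis_span ℝ _ _
  have hb := ZSpan.fundamentalDomain_isBounded b
  obtain ⟨D, hD, hD'⟩ := hb.exists_pos_norm_le
  have hm := ZSpan.fundamentalDomain_measurableSet b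
  refine ⟨ZSpan.fundamentalDomain b, D, hD, hm, hD', ?_, ?_⟩
  · rw [Measure.real, ENNReal.toReal_pos_iff]
    exact ⟨pos_iff_ne_zero.mpr (ZSpan.measure_fundamentalDomain_ne_zero _), hb.measure_lt_top⟩
  intro F _ _ f hf
  have hmem (x : 𝓞 K) : σ x ∈ (Submodule.span ℤ (Set.range b)) := by
    exact hspan.ge ⟨x, rfl⟩
  have hcount : Countable (𝓞 K) := by
    have e := Equiv.ofInjective _ (integerEmbedding_injective σ)
    have : Countable (LinearMap.range (integerEmbedding σ)) := inferInstance
    exact e.countable_iff.mpr this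
  have hpre (x : 𝓞 K) : MeasurableSet ((fun u => σ x + u) '' ZSpan.fundamentalDomain b) :=
    (measurableEmbedding_addLeft (σ x)).measurableSet_image.mpr hm
  have huniv : ⋃ x : 𝓞 K, (fun u => σ x + u) '' ZSpan.fundamentalDomain b = Set.univ := by
    rw [Set.eq_univ_iff_forall]
    intro z
    have hz : (ZSpan.floor b z : ℂ) ∈ LinearMap.range (integerEmbedding σ) := by
      exact hspan.le (ZSpan.floor b z).2
    obtain ⟨x, hx⟩ := hz
    refine Set.mem_iUnion.mpr ⟨x, ZSpan.fract b z, ZSpan.fract_mem_fundamentalDomain b z, ?_⟩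
    rw [integerEmbedding_apply] at hx
    simp only [hx, ZSpan.fract_apply]
    ring
  have hdisj : Pairwise (Function.onFun Disjoint
      fun x : 𝓞 K => (fun u => σ x + u) '' ZSpan.fundamentalDomain b) := by
    intro x y hxy
    refine Set.disjoint_left.mpr ?_
    rintro _ ⟨u, hu, rfl⟩ ⟨v, hv, huv⟩
    apply hxy
    have h1 := ZSpan.fract_zSpan_add b u (hmem x)
    have h2 := ZSpan.fract_zSpan_add b v (hmem y)
    simp only at huv
    rw [huv, h1, ZSpan.fract_eq_self.mpr hu, ZSpan.fract_eq_self.mpr hv] at h2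
    rw [h2] at huv
    exact integerEmbedding_injective σ (add_right_cancel huv).symm
  have h1 := hasSum_integral_iUnion hpre hdisj (f := f) (μ := volume) (by
    rw [huniv]; exact hf.integrableOn)
  rw [huniv, setIntegral_univ] at h1
  refine h1.congr_fun fun x => ?_
  exact ((measurePreserving_add_left volume (σ x)).setIntegral_image_emb
    (measurableEmbedding_addLeft _) _ _).symm

end Lattice

/-! ### Lattice sums against integrals, and integrals over discs -/

/-- On each cell `h` is compared with its value at the lattice point. The error is controlled by `E`
at the running point of the cell, so that the errors of all cells add up to exactly `∫ E`. -/
theorem IsCell.norm_sub_le {K : Type*} [Field K] {σ : K →+* ℂ} {P : Set ℂ} {D : ℝ} (hP : IsCell σ P D)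
    {h : ℂ → ℂ} {E : ℂ → ℝ} (hh : Integrable h) (hE : Integrable E)
    (hb : ∀ x z, ‖z - x‖ ≤ D → ‖h x - h z‖ ≤ E z) (s : Finset (𝓞 K))
    (hs : ∀ x ∉ s, h (σ x) = 0) :
    ‖(volume.real P : ℂ) * ∑ x ∈ s, h (σ x) - ∫ z, h z‖ ≤ ∫ z, E z := by
  have hPfin : volume P ≠ ⊤ := (ENNReal.toReal_pos_iff.mp hP.area_pos).2.ne
  have h1 := hP.hasSum h hh
  have h2 : HasSum (fun x : 𝓞 K => ∫ _ in P, h (σ x)) ((volume.real P : ℂ) * ∑ x ∈ s, h (σ x)) := by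
    simp only [setIntegral_const, Complex.real_smul]
    exact (hasSum_sum_of_ne_finset_zero hs).mul_left _
  refine (h2.sub h1).norm_le_of_bounded (hP.hasSum E hE) fun x => ?_
  have hi : IntegrableOn (fun u => h (σ x + u)) P := (hh.comp_add_left (σ x)).integrableOn
  have hc : IntegrableOn (fun _ => h (σ x)) P := integrableOn_const hPfin
  change ‖(∫ _ in P, h (σ x)) - ∫ u in P, h (σ x + u)‖ ≤ _
  rw [← integral_sub hc hi]
  refine norm_integral_le_of_norm_le (hE.comp_add_left (σ x)).integrableOn ?_
  refine (ae_restrict_iff' hP.measurableSet).mpr (ae_of_all _ fun u hu => ?_)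
  exact hb _ _ (by simpa using hP.norm_le u hu)

theorem integral_comp_mul_left_complex {F : Type*} [NormedAddCommGroup F] [NormedSpace ℝ F]
    (f : ℂ → F) {a : ℂ} (ha : a ≠ 0) :
    ∫ z, f (a * z) = (‖a‖ ^ 2)⁻¹ • ∫ z, f z := by
  have hn : ‖a‖ ≠ 0 := norm_ne_zero_iff.mpr ha
  let u : Circle := Circle.exp a.arg
  have e (z : ℂ) : f (a * z) = f (rotation u (‖a‖ • z)) := by
    rw [rotation_apply, Complex.real_smul, Circle.coe_exp]
    conv_lhs => rw [← Complex.norm_mul_exp_arg_mul_I a]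
    congr 1; ring
  simp_rw [e]
  rw [Measure.integral_comp_smul volume (fun z => f (rotation u z)) ‖a‖,
    (rotation u).measurePreserving.integral_comp (rotation u).toHomeomorph.measurableEmbedding]
  simp [abs_of_nonneg]

/-- `g` is continuous, bounded by `B`, and `ℓ`-Lipschitz up to an error `ε`. -/
structure IsApproxLip (g : ℂ → ℂ) (B ℓ ε : ℝ) : Prop where
  continuous : Continuous g
  lip_nonneg : 0 ≤ ℓ
  err_nonneg : 0 ≤ ε
  norm_le : ∀ z, ‖g z‖ ≤ B
  norm_sub_le : ∀ z w, ‖g z - g w‖ ≤ ε + ℓ * ‖z - w‖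

theorem IsApproxLip.bound_nonneg {g : ℂ → ℂ} {B ℓ ε : ℝ} (hg : IsApproxLip g B ℓ ε) : 0 ≤ B :=
  (norm_nonneg _).trans (hg.norm_le 0)

theorem IsApproxLip.comp_mul_left {g : ℂ → ℂ} {B ℓ ε : ℝ} (hg : IsApproxLip g B ℓ ε) (a : ℂ) :
    IsApproxLip (fun z => g (a * z)) B (ℓ * ‖a‖) ε where
  continuous := hg.continuous.comp (continuous_const.mul continuous_id)
  lip_nonneg := mul_nonneg hg.lip_nonneg (norm_nonneg _)
  err_nonneg := hg.err_nonneg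
  norm_le z := hg.norm_le _
  norm_sub_le z w := by
    refine (hg.norm_sub_le _ _).trans (le_of_eq ?_)
    rw [← mul_sub, norm_mul]; ring

theorem volume_real_ball (r : ℝ) : volume.real (Metric.ball (0 : ℂ) r) = Real.pi * (max r 0) ^ 2 := by
  rw [Measure.real, Complex.volume_ball]
  simp [ENNReal.toReal_ofReal', mul_comm]

theorem volume_real_closedBall (r : ℝ) :
    volume.real (Metric.closedBall (0 : ℂ) r) = Real.pi * (max r 0) ^ 2 := by
  rw [Measure.real, Complex.volume_closedBall]
  simp [ENNReal.toReal_ofReal', mul_comm]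

/-- The integral of `|z|² g(z)` over the disc of radius `R`. -/
def discIntegral (R : ℝ) (g : ℂ → ℂ) : ℂ :=
  ∫ z in Metric.closedBall (0 : ℂ) R, ((‖z‖ ^ 2 : ℝ) : ℂ) * g z

theorem IsApproxLip.integrableOn {g : ℂ → ℂ} {B ℓ ε : ℝ} (hg : IsApproxLip g B ℓ ε) (R : ℝ) :
    IntegrableOn (fun z => ((‖z‖ ^ 2 : ℝ) : ℂ) * g z) (Metric.closedBall 0 R) := by
  have := hg.continuous
  have hc : Continuous fun z => ((‖z‖ ^ 2 : ℝ) : ℂ) * g z := by fun_prop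
  exact hc.continuousOn.integrableOn_compact (isCompact_closedBall _ _)

theorem norm_discIntegral_le {g : ℂ → ℂ} {B R : ℝ} (hB : ∀ z, ‖g z‖ ≤ B) (hR : 0 ≤ R) :
    ‖discIntegral R g‖ ≤ Real.pi * B * R ^ 4 := by
  have h := norm_setIntegral_le_of_norm_le_const (μ := volume) (s := Metric.closedBall (0 : ℂ) R)
    (f := fun z => ((‖z‖ ^ 2 : ℝ) : ℂ) * g z) (C := R ^ 2 * B)
    measure_closedBall_lt_top (fun z hz => by
      rw [mem_closedBall_zero_iff] at hz
      rw [norm_mul, Complex.norm_real, norm_pow, norm_norm]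
      gcongr
      exact hB z)
  refine h.trans (le_of_eq ?_)
  rw [volume_real_closedBall, max_eq_left hR]
  ring

/-- In the fourth power, two factors come from the Jacobian and two from the weight `|z|²`. -/
theorem discIntegral_comp_mul (R : ℝ) (g : ℂ → ℂ) {a : ℂ} (ha : a ≠ 0) :
    discIntegral R g = ((‖a‖ ^ 4 : ℝ) : ℂ) * discIntegral (R / ‖a‖) (fun z => g (a * z)) := by
  have hn : 0 < ‖a‖ := norm_pos_iff.mpr ha
  rw [discIntegral, discIntegral, ← integral_indicator Metric.isClosed_closedBall.measurableSet,
    ← integral_indicator Metric.isClosed_closedBall.measurableSet]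
  set f := (Metric.closedBall (0 : ℂ) R).indicator (fun z => ((‖z‖ ^ 2 : ℝ) : ℂ) * g z) with hf
  have h := integral_comp_mul_left_complex f ha
  have e : (fun z => f (a * z)) = fun z => ((‖a‖ ^ 2 : ℝ) : ℂ) *
      (Metric.closedBall (0 : ℂ) (R / ‖a‖)).indicator
        (fun z => ((‖z‖ ^ 2 : ℝ) : ℂ) * g (a * z)) z := by
    ext z
    have hiff : a * z ∈ Metric.closedBall (0 : ℂ) R ↔ z ∈ Metric.closedBall (0 : ℂ) (R / ‖a‖) := by
      rw [mem_closedBall_zero_iff, mem_closedBall_zero_iff, le_div_iff₀ hn, norm_mul, mul_comm]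
    by_cases hz : z ∈ Metric.closedBall (0 : ℂ) (R / ‖a‖)
    · rw [hf, Set.indicator_of_mem (hiff.mpr hz), Set.indicator_of_mem hz, norm_mul]
      push_cast; ring
    · rw [hf, Set.indicator_of_notMem (fun h => hz (hiff.mp h)), Set.indicator_of_notMem hz]
      simp
  rw [e, integral_const_mul, Complex.real_smul] at h
  have hc : (‖a‖ : ℂ) ≠ 0 := by exact_mod_cast hn.ne'
  push_cast at h ⊢
  field_simp at h
  linear_combination -h


/-! ### Weighted lattice sums over discs, uniformly under scaling -/

section Lattice

variable {K : Type*} [Field K] {σ : K →+* ℂ} {P : Set ℂ} {D : ℝ}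

theorem norm_sq_mul_sub_le {g : ℂ → ℂ} {B ℓ ε M : ℝ} (hg : IsApproxLip g B ℓ ε) (hD : 0 ≤ D)
    {x z : ℂ} (hxz : ‖z - x‖ ≤ D) (hx : ‖x‖ ≤ M) (hz : ‖z‖ ≤ M) :
    ‖((‖x‖ ^ 2 : ℝ) : ℂ) * g x - ((‖z‖ ^ 2 : ℝ) : ℂ) * g z‖
      ≤ M ^ 2 * (ε + ℓ * D) + 2 * M * D * B := by
  have hM : 0 ≤ M := (norm_nonneg x).trans hx
  have e : ((‖x‖ ^ 2 : ℝ) : ℂ) * g x - ((‖z‖ ^ 2 : ℝ) : ℂ) * g z =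
      ((‖x‖ ^ 2 : ℝ) : ℂ) * (g x - g z) + ((‖x‖ ^ 2 - ‖z‖ ^ 2 : ℝ) : ℂ) * g z := by
    push_cast; ring
  rw [e]
  refine (norm_add_le _ _).trans (add_le_add ?_ ?_)
  · rw [norm_mul, Complex.norm_real, norm_pow, norm_norm]
    have h1 := hg.norm_sub_le x z
    have h2 : ε + ℓ * ‖x - z‖ ≤ ε + ℓ * D := by
      rw [norm_sub_rev]
      gcongr
      exact hg.lip_nonneg
    have := norm_nonneg (g x - g z)
    gcongr
    exact h1.trans h2
  · rw [norm_mul, Complex.norm_real]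
    have h1 : ‖‖x‖ ^ 2 - ‖z‖ ^ 2‖ ≤ 2 * M * D := by
      rw [show ‖x‖ ^ 2 - ‖z‖ ^ 2 = (‖x‖ + ‖z‖) * (‖x‖ - ‖z‖) by ring, norm_mul]
      have : ‖‖x‖ - ‖z‖‖ ≤ D := by
        rw [norm_sub_rev] at hxz
        exact (abs_norm_sub_norm_le x z).trans hxz
      have h3 : ‖‖x‖ + ‖z‖‖ ≤ 2 * M := by
        rw [Real.norm_of_nonneg (by positivity)]; linarith
      gcongr
    gcongr
    exact hg.norm_le z

/-- Lattice points in a disc: the weighted sum over `σ(𝓞 K)` is close to the integral. -/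
theorem IsCell.norm_sum_sub_discIntegral_le (hP : IsCell σ P D)
    {g : ℂ → ℂ} {B ℓ ε M : ℝ} (hg : IsApproxLip g B ℓ ε) (hM : 1 ≤ M) (s : Finset (𝓞 K))
    (hs : ∀ x, x ∈ s ↔ ‖σ x‖ ≤ M) :
    ‖(volume.real P : ℂ) * ∑ x ∈ s, ((‖σ x‖ ^ 2 : ℝ) : ℂ) * g (σ x) - discIntegral M g‖
      ≤ 8 * Real.pi * (1 + D) ^ 3 * ((ℓ * M + B) * M ^ 3 + ε * M ^ 4) := by
  have hD := hP.pos
  have hB := hg.bound_nonneg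
  have hℓ := hg.lip_nonneg
  have hε := hg.err_nonneg
  have hM0 : 0 ≤ M := by linarith
  set f : ℂ → ℂ := fun z => ((‖z‖ ^ 2 : ℝ) : ℂ) * g z with hf
  set c₁ := M ^ 2 * (ε + ℓ * D) + 2 * M * D * B with hc₁
  set c₂ := M ^ 2 * B with hc₂
  have hc₁0 : 0 ≤ c₁ := by positivity
  have hc₂0 : 0 ≤ c₂ := by positivity
  have hfb (z : ℂ) (hz : ‖z‖ ≤ M) : ‖f z‖ ≤ c₂ := by
    rw [hf, hc₂]
    simp only [norm_mul, Complex.norm_real, norm_pow, norm_norm]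
    gcongr
    exact hg.norm_le z
  -- When both points lie in the disc, the variation of `f` is at most `c₁`. When exactly one does,
  -- the cell meets the boundary circle, so `z` lies in the annulus `A` and the trivial bound `c₂`
  -- is used. The area of `A` is only `O(M)`, which saves the factor `M`.
  set Ω := Metric.closedBall (0 : ℂ) (M + D)
  set A := Metric.closedBall (0 : ℂ) (M + D) \ Metric.ball (0 : ℂ) (M - D)
  have hΩm : MeasurableSet Ω := Metric.isClosed_closedBall.measurableSet
  have hAm : MeasurableSet A := hΩm.diff Metric.isOpen_ball.measurableSet
  have hΩfin : volume Ω ≠ ⊤ := measure_closedBall_lt_top.ne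
  have hAfin : volume A ≠ ⊤ := (lt_of_le_of_lt (measure_mono Set.sdiff_subset)
    measure_closedBall_lt_top).ne
  let E : ℂ → ℝ := fun z => Ω.indicator (fun _ => c₁) z + A.indicator (fun _ => c₂) z
  have hE1 : Integrable (Ω.indicator fun _ => c₁) :=
    (integrable_indicator_iff hΩm).mpr (integrableOn_const hΩfin)
  have hE2 : Integrable (A.indicator fun _ => c₂) :=
    (integrable_indicator_iff hAm).mpr (integrableOn_const hAfin)
  set h : ℂ → ℂ := (Metric.closedBall (0 : ℂ) M).indicator f with hh
  have hhi : Integrable h :=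
    (integrable_indicator_iff Metric.isClosed_closedBall.measurableSet).mpr (hg.integrableOn M)
  have hbound : ∀ x z, ‖z - x‖ ≤ D → ‖h x - h z‖ ≤ E z := by
    intro x z hxz
    have hE1' : 0 ≤ Ω.indicator (fun _ => c₁) z := Set.indicator_nonneg (fun _ _ => hc₁0) _
    have hE2' : 0 ≤ A.indicator (fun _ => c₂) z := Set.indicator_nonneg (fun _ _ => hc₂0) _
    have hzx : ‖z‖ ≤ ‖x‖ + D := by
      have := norm_sub_norm_le z x; linarith
    have hxz' : ‖x‖ ≤ ‖z‖ + D := by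
      have := norm_sub_norm_le x z; rw [norm_sub_rev] at this; linarith
    by_cases hx : ‖x‖ ≤ M <;> by_cases hz : ‖z‖ ≤ M
    · have h1 : h x = f x := Set.indicator_of_mem (by simpa using hx) _
      have h2 : h z = f z := Set.indicator_of_mem (by simpa using hz) _
      have h3 : Ω.indicator (fun _ => c₁) z = c₁ := Set.indicator_of_mem (by
        simp only [Ω, mem_closedBall_zero_iff]; linarith) _
      rw [h1, h2]
      have := norm_sq_mul_sub_le hg hD.le hxz hx hz
      simp only [E, h3]
      linarith
    · have h1 : h x = f x := Set.indicator_of_mem (by simpa using hx) _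
      have h2 : h z = 0 := Set.indicator_of_notMem (by simpa using hz) _
      have h3 : A.indicator (fun _ => c₂) z = c₂ := Set.indicator_of_mem (by
        simp only [A, Set.mem_sdiff, mem_closedBall_zero_iff, mem_ball_zero_iff]
        constructor <;> linarith) _
      rw [h1, h2, sub_zero]
      simp only [E, h3]
      linarith [hfb x hx]
    · have h1 : h x = 0 := Set.indicator_of_notMem (by simpa using hx) _
      have h2 : h z = f z := Set.indicator_of_mem (by simpa using hz) _
      have h3 : A.indicator (fun _ => c₂) z = c₂ := Set.indicator_of_mem (by
        simp only [A, Set.mem_sdiff, mem_closedBall_zero_iff, mem_ball_zero_iff]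
        constructor <;> linarith) _
      rw [h1, h2, zero_sub, norm_neg]
      simp only [E, h3]
      linarith [hfb z hz]
    · have h1 : h x = 0 := Set.indicator_of_notMem (by simpa using hx) _
      have h2 : h z = 0 := Set.indicator_of_notMem (by simpa using hz) _
      rw [h1, h2, sub_zero, norm_zero]
      simp only [E]
      positivity
  have key := hP.norm_sub_le hhi (hE1.add hE2) hbound s (fun x hx =>
    Set.indicator_of_notMem (by rw [mem_closedBall_zero_iff]; exact fun h' => hx ((hs x).mpr h')) _)
  have hsum : ∑ x ∈ s, h (σ x) = ∑ x ∈ s, f (σ x) := Finset.sum_congr rfl fun x hx =>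
    Set.indicator_of_mem (by rw [mem_closedBall_zero_iff]; exact (hs x).mp hx) _
  have hint : ∫ z, h z = discIntegral M g :=
    integral_indicator Metric.isClosed_closedBall.measurableSet
  have hEint : ∫ z, E z = volume.real Ω * c₁ + volume.real A * c₂ := by
    rw [integral_add hE1 hE2, integral_indicator_const _ hΩm, integral_indicator_const _ hAm]
    simp
  rw [hsum, hint] at key
  refine key.trans ?_
  change ∫ z, E z ≤ _
  rw [hEint]
  have hπ := Real.pi_pos
  have hΩ : volume.real Ω ≤ Real.pi * (1 + D) ^ 2 * M ^ 2 := by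
    rw [volume_real_closedBall, max_eq_left (by positivity), mul_assoc, ← mul_pow]
    gcongr
    nlinarith
  have hA : volume.real A ≤ 4 * Real.pi * (1 + D) ^ 2 * M := by
    rw [measureReal_sdiff (by
      exact (Metric.ball_subset_closedBall.trans (Metric.closedBall_subset_closedBall (by linarith))))
      Metric.isOpen_ball.measurableSet, volume_real_closedBall, volume_real_ball,
      max_eq_left (by positivity)]
    rcases le_total D M with hDM | hDM
    · rw [max_eq_left (by linarith)]
      nlinarith [mul_nonneg hπ.le (mul_nonneg hM0 (sq_nonneg D)), mul_nonneg hπ.le (mul_nonneg hM0 hD.le), mul_nonneg hπ.le hM0]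
    · rw [max_eq_right (by linarith)]
      have : (M + D) ^ 2 ≤ 4 * (1 + D) ^ 2 * M := by nlinarith
      nlinarith
  calc volume.real Ω * c₁ + volume.real A * c₂
      ≤ Real.pi * (1 + D) ^ 2 * M ^ 2 * c₁ + 4 * Real.pi * (1 + D) ^ 2 * M * c₂ := by gcongr
    _ = Real.pi * (1 + D) ^ 2 * (M ^ 4 * ε + D * (ℓ * M ^ 4) + (2 * D + 4) * (M ^ 3 * B)) := by
        rw [hc₁, hc₂]; ring
    _ ≤ Real.pi * (1 + D) ^ 2 * (8 * (1 + D) * (M ^ 4 * ε) + 8 * (1 + D) * (ℓ * M ^ 4)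
          + 8 * (1 + D) * (M ^ 3 * B)) := by
        have h1 : 0 ≤ M ^ 4 * ε := by positivity
        have h2 : 0 ≤ ℓ * M ^ 4 := by positivity
        have h3 : 0 ≤ M ^ 3 * B := by positivity
        have h4 : M ^ 4 * ε ≤ 8 * (1 + D) * (M ^ 4 * ε) := le_mul_of_one_le_left h1 (by linarith)
        have h5 : D * (ℓ * M ^ 4) ≤ 8 * (1 + D) * (ℓ * M ^ 4) :=
          mul_le_mul_of_nonneg_right (by linarith) h2
        have h6 : (2 * D + 4) * (M ^ 3 * B) ≤ 8 * (1 + D) * (M ^ 3 * B) :=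
          mul_le_mul_of_nonneg_right (by linarith) h3
        gcongr
    _ = _ := by ring

theorem IsCell.card_le (hP : IsCell σ P D) {M : ℝ} (hM : 1 ≤ M) (s : Finset (𝓞 K))
    (hs : ∀ x, x ∈ s ↔ ‖σ x‖ ≤ M) :
    volume.real P * s.card ≤ 2 * Real.pi * (1 + D) ^ 2 * M ^ 2 := by
  have hD := hP.pos
  have hm (R : ℝ) : MeasurableSet (Metric.closedBall (0 : ℂ) R) :=
    Metric.isClosed_closedBall.measurableSet
  have hfin (R : ℝ) : volume (Metric.closedBall (0 : ℂ) R) ≠ ⊤ := measure_closedBall_lt_top.ne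
  set h : ℂ → ℂ := (Metric.closedBall (0 : ℂ) M).indicator fun _ => 1 with hh
  set E : ℂ → ℝ := (Metric.closedBall (0 : ℂ) (M + D)).indicator fun _ => 1 with hE
  have hhi : Integrable h := (integrable_indicator_iff (hm _)).mpr (integrableOn_const (hfin _))
  have hEi : Integrable E := (integrable_indicator_iff (hm _)).mpr (integrableOn_const (hfin _))
  have hbound : ∀ x z, ‖z - x‖ ≤ D → ‖h x - h z‖ ≤ E z := by
    intro x z hxz
    have hzx : ‖z‖ ≤ ‖x‖ + D := by
      have := norm_sub_norm_le z x; linarith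
    classical
    simp only [hh, hE, Set.indicator_apply, mem_closedBall_zero_iff]
    split_ifs <;> simp <;> linarith
  have key := hP.norm_sub_le hhi hEi hbound s (fun x hx =>
    Set.indicator_of_notMem (by rw [mem_closedBall_zero_iff]; exact fun h' => hx ((hs x).mpr h')) _)
  have hsum : ∑ x ∈ s, h (σ x) = s.card := by
    rw [Finset.sum_congr rfl fun x hx => Set.indicator_of_mem (f := fun _ => (1 : ℂ))
      (by rw [mem_closedBall_zero_iff]; exact (hs x).mp hx)]
    simp
  have hint : ∫ z, h z = ((Real.pi * M ^ 2 : ℝ) : ℂ) := by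
    rw [hh, integral_indicator_const _ (hm _), volume_real_closedBall, max_eq_left (by linarith)]
    simp
  have hEint : ∫ z, E z = Real.pi * (M + D) ^ 2 := by
    rw [hE, integral_indicator_const _ (hm _), volume_real_closedBall, max_eq_left (by linarith)]
    simp
  rw [hsum, hint, hEint] at key
  have hre := (Complex.re_le_norm _).trans key
  simp only [Complex.sub_re, Complex.re_ofReal_mul, Complex.natCast_re, Complex.ofReal_re] at hre
  have h1 : (M + D) ^ 2 ≤ (1 + D) ^ 2 * M ^ 2 := by
    rw [← mul_pow]; gcongr; nlinarith
  have h2 : M ^ 2 ≤ (1 + D) ^ 2 * M ^ 2 := le_mul_of_one_le_left (by positivity) (by nlinarith)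
  have := Real.pi_pos
  nlinarith

/-- Rescaling by `a` reduces to the unscaled lattice when `‖a‖ ≤ N`. When `‖a‖ > N` only the origin
can be in range, so the sum vanishes, and the integral is itself within the error because `N / ‖a‖ <
1`. The bound thus holds for all `a ≠ 0`, as needed to sum over infinitely many ideals. -/
theorem IsCell.norm_sum_mul_sub_discIntegral_le (hP : IsCell σ P D)
    (h1 : ∀ x : 𝓞 K, x ≠ 0 → 1 ≤ ‖σ x‖)
    {g : ℂ → ℂ} {B ℓ ε N : ℝ} (hg : IsApproxLip g B ℓ ε) (hN : 0 < N) {a : ℂ} (ha : a ≠ 0)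
    (s : Finset (𝓞 K)) (hs : ∀ x, x ∈ s ↔ ‖a * σ x‖ ≤ N) :
    ‖(volume.real P : ℂ) * ∑ x ∈ s, ((‖a * σ x‖ ^ 2 : ℝ) : ℂ) * g (a * σ x)
        - ((‖a‖ ^ 2 : ℝ) : ℂ)⁻¹ * discIntegral N g‖
      ≤ 8 * Real.pi * (1 + D) ^ 3 * ((ℓ * N + B) * N ^ 3 / ‖a‖ + ε * N ^ 4 / ‖a‖ ^ 2) := by
  have hD := hP.pos
  have hB := hg.bound_nonneg
  have hℓ := hg.lip_nonneg
  have hε := hg.err_nonneg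
  have hπ := Real.pi_pos
  have hA : 0 < ‖a‖ := norm_pos_iff.mpr ha
  have hAc : (‖a‖ : ℂ) ≠ 0 := by exact_mod_cast hA.ne'
  have hs' : ∀ x, x ∈ s ↔ ‖σ x‖ ≤ N / ‖a‖ := fun x => by
    rw [hs, le_div_iff₀ hA, norm_mul, mul_comm]
  rcases le_or_gt 1 (N / ‖a‖) with hM | hM
  · have key := hP.norm_sum_sub_discIntegral_le (hg.comp_mul_left a) hM s hs'
    have e : (volume.real P : ℂ) * ∑ x ∈ s, ((‖a * σ x‖ ^ 2 : ℝ) : ℂ) * g (a * σ x)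
        - ((‖a‖ ^ 2 : ℝ) : ℂ)⁻¹ * discIntegral N g = ((‖a‖ ^ 2 : ℝ) : ℂ) *
        ((volume.real P : ℂ) * ∑ x ∈ s, ((‖σ x‖ ^ 2 : ℝ) : ℂ) * g (a * σ x)
          - discIntegral (N / ‖a‖) (fun z => g (a * z))) := by
      rw [discIntegral_comp_mul N g ha, mul_sub]
      congr 1
      · rw [Finset.mul_sum, Finset.mul_sum, Finset.mul_sum]
        refine Finset.sum_congr rfl fun x _ => ?_
        rw [norm_mul]; push_cast; ring
      · push_cast
        field_simp
    rw [e, norm_mul, Complex.norm_real, Real.norm_of_nonneg (by positivity)]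
    refine (mul_le_mul_of_nonneg_left key (by positivity)).trans (le_of_eq ?_)
    field_simp
  · have hNA : N ≤ ‖a‖ := by rw [div_lt_one hA] at hM; exact hM.le
    have hzero : ∑ x ∈ s, ((‖a * σ x‖ ^ 2 : ℝ) : ℂ) * g (a * σ x) = 0 := by
      refine Finset.sum_eq_zero fun x hx => ?_
      have hx0 : x = 0 := by
        by_contra hne
        linarith [h1 x hne, (hs' x).mp hx]
      simp [hx0]
    rw [hzero, mul_zero, zero_sub, norm_neg, norm_mul, norm_inv, Complex.norm_real,
      Real.norm_of_nonneg (by positivity)]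
    have hd := norm_discIntegral_le hg.norm_le hN.le
    calc (‖a‖ ^ 2)⁻¹ * ‖discIntegral N g‖ ≤ (‖a‖ ^ 2)⁻¹ * (Real.pi * B * N ^ 4) := by gcongr
      _ = Real.pi * (B * N ^ 3 / ‖a‖) * (N / ‖a‖) := by field_simp
      _ ≤ Real.pi * (B * N ^ 3 / ‖a‖) * 1 := by gcongr
      _ ≤ 8 * Real.pi * (1 + D) ^ 3 * (B * N ^ 3 / ‖a‖) := by
        rw [mul_one]
        gcongr
        have : 1 ≤ (1 + D) ^ 3 := one_le_pow₀ (by linarith)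
        nlinarith
      _ ≤ _ := by
        gcongr
        have h4 : B * N ^ 3 / ‖a‖ ≤ (ℓ * N + B) * N ^ 3 / ‖a‖ := by
          gcongr
          nlinarith
        have h5 : 0 ≤ ε * N ^ 4 / ‖a‖ ^ 2 := by positivity
        linarith

end Lattice

/-! ### The Euler function by inclusion-exclusion -/

section Totient

variable {K : Type*} [Field K]

/-- The intersection of the prime ideals in a finite set. -/
def primeInf (T : Finset (HeightOneSpectrum (𝓞 K))) : Ideal (𝓞 K) := T.inf fun v => v.asIdeal

theorem mem_primeInf {T : Finset (HeightOneSpectrum (𝓞 K))} {x : 𝓞 K} :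
    x ∈ primeInf T ↔ ∀ v ∈ T, x ∈ v.asIdeal := by
  rw [primeInf, Finset.inf_eq_iInf]
  simp [Submodule.mem_iInf]

/-- A nonunit of the quotient lies in a maximal ideal, whose preimage is a prime containing `a`,
hence nonzero. -/
theorem isUnit_mk_iff {a x : 𝓞 K} (ha : a ≠ 0) :
    IsUnit (Ideal.Quotient.mk (Ideal.span {a}) x) ↔
      ∀ v : HeightOneSpectrum (𝓞 K), a ∈ v.asIdeal → x ∉ v.asIdeal := by
  constructor
  · intro hu v hav hxv
    have hle : Ideal.span {a} ≤ v.asIdeal := (Ideal.span_singleton_le_iff_mem _).mpr hav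
    have := hu.map (Ideal.Quotient.factor hle)
    rw [Ideal.Quotient.factor_mk, Ideal.Quotient.eq_zero_iff_mem.mpr hxv] at this
    have := v.isPrime
    exact not_isUnit_zero ‹_›
  · intro h
    by_contra hu
    obtain ⟨M, hM, hxM⟩ := exists_max_ideal_of_mem_nonunits hu
    have hp : (M.comap (Ideal.Quotient.mk (Ideal.span {a}))).IsPrime := Ideal.comap_isPrime _ _
    have haM : a ∈ M.comap (Ideal.Quotient.mk (Ideal.span {a})) := by
      rw [Ideal.mem_comap, Ideal.Quotient.eq_zero_iff_mem.mpr (Ideal.mem_span_singleton_self a)]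
      exact M.zero_mem
    refine h ⟨_, hp, fun hb => ha ?_⟩ haM hxM
    rw [hb] at haM
    exact haM

variable [NumberField K]

/-- The prime ideals of `𝓞 K` containing a nonzero `a`. -/
theorem finite_primes_mem {a : 𝓞 K} (ha : a ≠ 0) :
    {v : HeightOneSpectrum (𝓞 K) | a ∈ v.asIdeal}.Finite := by
  have h := Ideal.finite_factors (R := 𝓞 K) (I := Ideal.span {a})
    (by rwa [Ne, Submodule.zero_eq_bot, Ideal.span_singleton_eq_bot])
  refine h.subset fun v hv => ?_
  rw [Set.mem_ofPred_eq, Ideal.dvd_span_singleton]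
  exact hv

theorem primeInf_eq_prod (T : Finset (HeightOneSpectrum (𝓞 K))) :
    primeInf T = ∏ v ∈ T, v.asIdeal := by
  have h := HeightOneSpectrum.inf_pow_eq_prod T (fun _ => 1) id (fun i _ j _ hij => hij)
  simpa [primeInf] using h

theorem absNorm_primeInf (T : Finset (HeightOneSpectrum (𝓞 K))) :
    Ideal.absNorm (primeInf T) = ∏ v ∈ T, Ideal.absNorm v.asIdeal := by
  rw [primeInf_eq_prod, map_prod]

theorem absNorm_pos {I : Ideal (𝓞 K)} (hI : I ≠ ⊥) : 0 < Ideal.absNorm I :=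
  Nat.pos_of_ne_zero fun h => hI (Ideal.absNorm_eq_zero_iff.mp h)

theorem one_lt_absNorm (v : HeightOneSpectrum (𝓞 K)) : 1 < Ideal.absNorm v.asIdeal := by
  have h0 := absNorm_pos v.ne_bot
  have h1 : Ideal.absNorm v.asIdeal ≠ 1 := fun h =>
    v.isPrime.ne_top (Ideal.absNorm_eq_one_iff.mp h)
  omega

/-- The number of classes modulo `a` lying in an ideal `I ∋ a` is `N(a) / N(I)`. -/
theorem card_map_mk_mul_absNorm {a : 𝓞 K} (I : Ideal (𝓞 K)) (ha : a ∈ I) :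
    Nat.card {x : 𝓞 K ⧸ Ideal.span {a} // x ∈ I.map (Ideal.Quotient.mk (Ideal.span {a}))}
      * Ideal.absNorm I = Ideal.absNorm (Ideal.span {a}) := by
  have hle : Ideal.span {a} ≤ I := (Ideal.span_singleton_le_iff_mem I).mpr ha
  have h := Submodule.card_eq_card_quotient_mul_card
    (I.map (Ideal.Quotient.mk (Ideal.span {a})))
  have e := (DoubleQuot.quotQuotEquivQuotOfLE hle).toEquiv
  rw [Ideal.absNorm_apply, Ideal.absNorm_apply, Submodule.cardQuot_apply, Submodule.cardQuot_apply,
    h, Nat.card_congr e]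

/-- Inclusion-exclusion formula for the Euler function. -/
theorem eulerPhi_eq_sum {a : 𝓞 K} (ha : a ≠ 0) :
    (eulerPhi a : ℝ) = ∑ T ∈ (finite_primes_mem ha).toFinset.powerset,
      (Ideal.absNorm (Ideal.span {a}) : ℝ) * ∏ v ∈ T, (-(Ideal.absNorm v.asIdeal : ℝ)⁻¹) := by
  classical
  set S := (finite_primes_mem ha).toFinset with hS
  have hSm (v) : v ∈ S ↔ a ∈ v.asIdeal := by simp [hS]
  have hfin : Finite (𝓞 K ⧸ Ideal.span {a}) :=
    Ideal.finiteQuotientOfFreeOfNeBot _ (by rwa [Ne, Ideal.span_singleton_eq_bot])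
  have := Fintype.ofFinite (𝓞 K ⧸ Ideal.span {a})
  let q := Ideal.Quotient.mk (Ideal.span {a})
  have hmap (I : Ideal (𝓞 K)) (haI : a ∈ I) (x : 𝓞 K) : q x ∈ I.map q ↔ x ∈ I := by
    have hle : Ideal.span {a} ≤ I := (Ideal.span_singleton_le_iff_mem I).mpr haI
    rw [Ideal.mem_quotient_iff_mem hle]
  have hcard : (eulerPhi a : ℝ) = ∑ x : 𝓞 K ⧸ Ideal.span {a}, if IsUnit x then (1 : ℝ) else 0 := by
    rw [Finset.sum_boole, eulerPhi, Nat.card_congr (Equiv.ofInjective _ Units.val_injective),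
      Nat.card_eq_fintype_card, Fintype.card_subtype]
    rfl
  rw [hcard]
  -- The indicator of the units is `∏ (1 - 1_{y ∈ v})` over the primes `v` containing `a`. Expanding
  -- it, the subset `T` contributes `(-1) ^ T.card` times the indicator of `primeInf T`.
  have hx (x : 𝓞 K ⧸ Ideal.span {a}) : (if IsUnit x then (1 : ℝ) else 0) =
      ∑ T ∈ S.powerset, (-1) ^ T.card * (if x ∈ (primeInf T).map q then 1 else 0) := by
    obtain ⟨y, rfl⟩ := Ideal.Quotient.mk_surjective x
    have h1 : (if IsUnit (Ideal.Quotient.mk (Ideal.span {a}) y) then (1 : ℝ) else 0) =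
        ∏ v ∈ S, (1 + -(if y ∈ v.asIdeal then (1 : ℝ) else 0)) := by
      by_cases h : ∀ v : HeightOneSpectrum (𝓞 K), a ∈ v.asIdeal → y ∉ v.asIdeal
      · rw [if_pos ((isUnit_mk_iff ha).mpr h)]
        refine (Finset.prod_eq_one fun v hv => ?_).symm
        rw [if_neg (h v ((hSm v).mp hv))]; simp
      · rw [if_neg fun hu => h ((isUnit_mk_iff ha).mp hu)]
        push Not at h
        obtain ⟨v, hav, hyv⟩ := h
        refine (Finset.prod_eq_zero ((hSm v).mpr hav) ?_).symm
        rw [if_pos hyv]; simp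
    rw [h1, Finset.prod_one_add]
    refine Finset.sum_congr rfl fun T hT => ?_
    rw [Finset.prod_neg]
    congr 1
    have haT : a ∈ primeInf T := mem_primeInf.mpr fun v hv =>
      (hSm v).mp (Finset.mem_powerset.mp hT hv)
    rw [Finset.prod_boole]
    exact if_congr (by rw [hmap _ haT, mem_primeInf]) rfl rfl
  simp_rw [hx]
  rw [Finset.sum_comm]
  refine Finset.sum_congr rfl fun T hT => ?_
  have haT : a ∈ primeInf T := mem_primeInf.mpr fun v hv =>
    (hSm v).mp (Finset.mem_powerset.mp hT hv)
  rw [← Finset.mul_sum, Finset.sum_boole, Finset.prod_neg, ← card_map_mk_mul_absNorm _ haT,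
    absNorm_primeInf, Finset.prod_inv_distrib]
  have hne : (∏ v ∈ T, (Ideal.absNorm v.asIdeal : ℝ)) ≠ 0 :=
    Finset.prod_ne_zero_iff.mpr fun v _ => by exact_mod_cast (absNorm_pos v.ne_bot).ne'
  rw [Nat.card_eq_fintype_card, Fintype.card_subtype]
  push_cast
  field_simp
  rfl

theorem eulerPhi_le (a : 𝓞 K) (ha : a ≠ 0) : eulerPhi a ≤ Ideal.absNorm (Ideal.span {a}) := by
  have hfin : Finite (𝓞 K ⧸ Ideal.span {a}) :=
    Ideal.finiteQuotientOfFreeOfNeBot _ (by rwa [Ne, Ideal.span_singleton_eq_bot])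
  rw [Ideal.absNorm_apply, Submodule.cardQuot_apply, eulerPhi]
  exact Nat.card_le_card_of_injective _ Units.val_injective

end Totient

/-! ### Norms of the ideals `Λ ⊓ primeInf T` and convergence over primes -/

section PrimeSums

variable {K : Type*} [Field K]

/-- A generator of an ideal. -/
def idealGen [IsPrincipalIdealRing (𝓞 K)] (I : Ideal (𝓞 K)) : 𝓞 K := Submodule.IsPrincipal.generator I

theorem span_idealGen [IsPrincipalIdealRing (𝓞 K)] (I : Ideal (𝓞 K)) : Ideal.span {idealGen I} = I :=
  Ideal.span_singleton_generator I

variable [NumberField K]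

/-- Primes containing `Λ` impose no further condition, and the product of the others is coprime to
`Λ`. -/
theorem inf_primeInf_eq_mul (Λ : Ideal (𝓞 K)) (T : Finset (HeightOneSpectrum (𝓞 K))) :
    haveI := Classical.decPred fun v : HeightOneSpectrum (𝓞 K) => Λ ≤ v.asIdeal
    Λ ⊓ primeInf T = Λ * primeInf (T.filter fun v => ¬ Λ ≤ v.asIdeal) := by
  classical
  have h1 : Λ ⊓ primeInf T = Λ ⊓ primeInf (T.filter fun v => ¬ Λ ≤ v.asIdeal) := by
    ext x
    simp only [Ideal.mem_inf, mem_primeInf, Finset.mem_filter]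
    refine and_congr_right fun hx => ⟨fun h v hv => h v hv.1, fun h v hv => ?_⟩
    by_cases hΛ : Λ ≤ v.asIdeal
    · exact hΛ hx
    · exact h v ⟨hv, hΛ⟩
  have hco : IsCoprime Λ (primeInf (T.filter fun v => ¬ Λ ≤ v.asIdeal)) := by
    rw [primeInf_eq_prod]
    refine IsCoprime.prod_right fun v hv => ?_
    rw [Ideal.isCoprime_iff_sup_eq]
    have hmax : v.asIdeal.IsMaximal := v.isMaximal
    rw [sup_comm]
    exact (Ideal.isMaximal_def.mp hmax).2 _ (lt_of_le_of_ne le_sup_left fun h =>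
      (Finset.mem_filter.mp hv).2 (h ▸ le_sup_right))
  rw [h1, Ideal.mul_eq_inf_of_isCoprime hco]

theorem absNorm_inf_primeInf (Λ : Ideal (𝓞 K)) (T : Finset (HeightOneSpectrum (𝓞 K))) :
    haveI := Classical.decPred fun v : HeightOneSpectrum (𝓞 K) => Λ ≤ v.asIdeal
    Ideal.absNorm (Λ ⊓ primeInf T) = Ideal.absNorm Λ *
      ∏ v ∈ T, if Λ ≤ v.asIdeal then 1 else Ideal.absNorm v.asIdeal := by
  classical
  rw [inf_primeInf_eq_mul, map_mul, absNorm_primeInf, Finset.prod_filter]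
  congr 1
  refine Finset.prod_congr rfl fun v _ => ?_
  split_ifs <;> simp_all

theorem inf_primeInf_ne_bot {Λ : Ideal (𝓞 K)} (hΛ : Λ ≠ ⊥)
    (T : Finset (HeightOneSpectrum (𝓞 K))) : Λ ⊓ primeInf T ≠ ⊥ := by
  classical
  intro h
  have h1 := absNorm_inf_primeInf Λ T
  rw [h, Ideal.absNorm_bot] at h1
  refine mul_ne_zero (absNorm_pos hΛ).ne' (Finset.prod_ne_zero_iff.mpr fun v _ => ?_) h1.symm
  split_ifs
  · exact one_ne_zero
  · exact (absNorm_pos v.ne_bot).ne'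

variable [NumberField.IsTotallyComplex K]

/-- The exponent `3` exceeds the rank `2` of the lattice. -/
theorem summable_norm_inv_pow (h2 : Module.finrank ℚ K = 2) (σ : K →+* ℂ) :
    Summable fun x : 𝓞 K => ‖σ x‖⁻¹ ^ 3 := by
  have := discreteTopology_range h2 σ
  have := isZLattice_range h2 σ
  have hr : Module.finrank ℤ (LinearMap.range (integerEmbedding σ)) = 2 := by
    rw [ZLattice.rank ℝ, Complex.finrank_real_complex]
  have h := ZLattice.summable_norm_pow_inv (LinearMap.range (integerEmbedding σ)) 3 (by omega)
  exact (Equiv.ofInjective _ (integerEmbedding_injective σ)).summable_iff.mpr h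


variable [IsPrincipalIdealRing (𝓞 K)]

theorem norm_generator_sq (h2 : Module.finrank ℚ K = 2) (σ : K →+* ℂ) (I : Ideal (𝓞 K)) :
    ‖σ (idealGen I)‖ ^ 2 = (Ideal.absNorm I : ℝ) := by
  rw [norm_sq_eq_absNorm h2 σ]
  congr 2
  exact span_idealGen I

/-- Choosing a generator embeds the primes in `𝓞 K`, so this is a subseries of the lattice sum. -/
theorem summable_absNorm_rpow (h2 : Module.finrank ℚ K = 2) (σ : K →+* ℂ) :
    Summable fun v : HeightOneSpectrum (𝓞 K) => (Real.sqrt (Ideal.absNorm v.asIdeal))⁻¹ ^ 3 := by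
  have hinj : Function.Injective fun v : HeightOneSpectrum (𝓞 K) =>
      idealGen v.asIdeal := fun v w h => by
    apply HeightOneSpectrum.ext
    rw [← span_idealGen v.asIdeal, ← span_idealGen w.asIdeal]
    exact congrArg (fun x => Ideal.span {x}) h
  refine ((summable_norm_inv_pow h2 σ).comp_injective hinj).congr fun v => ?_
  rw [← norm_generator_sq h2 σ, Real.sqrt_sq (norm_nonneg _)]
  rfl

/-- The coefficient of the prime set `T` in the inclusion-exclusion formula for `φ_K(a) / N(a)`. -/
def moebiusWeight (T : Finset (HeightOneSpectrum (𝓞 K))) : ℝ :=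
  ∏ v ∈ T, (-(Ideal.absNorm v.asIdeal : ℝ)⁻¹)

/-- The mean value `∑_T w_T / N(Λ ∩ ⋂ T)` of `φ_K(a) / N(a)` over `a ∈ Λ`, up to the covolume. -/
def meanDensity (Λ : Ideal (𝓞 K)) : ℝ :=
  ∑' T : Finset (HeightOneSpectrum (𝓞 K)),
    moebiusWeight T * (Ideal.absNorm (Λ ⊓ primeInf T) : ℝ)⁻¹

/-- The sum over `T` factors as an Euler product of positive factors `1 + a v`. As `a` is summable,
the logarithms converge, and the product is an exponential. Positivity is what later allows division
by the total mass. -/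
theorem meanDensity_pos (h2 : Module.finrank ℚ K = 2) (σ : K →+* ℂ) {Λ : Ideal (𝓞 K)}
    (hΛ : Λ ≠ ⊥) : 0 < meanDensity Λ := by
  classical
  let a : HeightOneSpectrum (𝓞 K) → ℝ := fun v =>
    -(Ideal.absNorm v.asIdeal : ℝ)⁻¹ * (if Λ ≤ v.asIdeal then 1 else (Ideal.absNorm v.asIdeal : ℝ)⁻¹)
  have hN (v : HeightOneSpectrum (𝓞 K)) : 1 < (Ideal.absNorm v.asIdeal : ℝ) := by
    exact_mod_cast one_lt_absNorm v
  have hsum : Summable a := by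
    have h1 : Summable fun v : HeightOneSpectrum (𝓞 K) =>
        -((Ideal.absNorm v.asIdeal : ℝ)⁻¹ * (Ideal.absNorm v.asIdeal : ℝ)⁻¹) := by
      refine (Summable.of_nonneg_of_le (fun v => ?_) (fun v => ?_)
        (summable_absNorm_rpow h2 σ)).neg
      · positivity
      · have hs : Real.sqrt (Ideal.absNorm v.asIdeal) ^ 2 = Ideal.absNorm v.asIdeal :=
          Real.sq_sqrt (by positivity)
        have hs1 : 1 ≤ Real.sqrt (Ideal.absNorm v.asIdeal) :=
          Real.one_le_sqrt.mpr (hN v).le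
        rw [← mul_inv, inv_pow]
        refine inv_anti₀ (by positivity) ?_
        calc Real.sqrt (Ideal.absNorm v.asIdeal) ^ 3
            ≤ Real.sqrt (Ideal.absNorm v.asIdeal) ^ 4 := pow_le_pow_right₀ hs1 (by norm_num)
          _ = (Real.sqrt (Ideal.absNorm v.asIdeal) ^ 2) * Real.sqrt (Ideal.absNorm v.asIdeal) ^ 2 := by
            ring
          _ = _ := by rw [hs]
    -- The finitely many primes containing `Λ`, where the term is `-1 / N(v)` instead of `-1 /
    -- N(v)²`, do not affect summability.
    refine h1.congr_cofinite ?_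
    have hfin := Ideal.finite_factors (R := 𝓞 K) (I := Λ) hΛ
    filter_upwards [hfin.compl_mem_cofinite] with v hv
    have : ¬ Λ ≤ v.asIdeal := fun h => hv (Ideal.dvd_iff_le.mpr h)
    simp [a, this]
  have hpos (v : HeightOneSpectrum (𝓞 K)) : 0 < 1 + a v := by
    have h1 : (Ideal.absNorm v.asIdeal : ℝ)⁻¹ < 1 := inv_lt_one_of_one_lt₀ (hN v)
    have h0 : 0 < (Ideal.absNorm v.asIdeal : ℝ)⁻¹ := inv_pos.mpr (by linarith [hN v])
    simp only [a]
    split_ifs <;> nlinarith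
  have hprod : meanDensity Λ = (Ideal.absNorm Λ : ℝ)⁻¹ * ∏' v, (1 + a v) := by
    rw [tprod_one_add (summable_finsetProd_of_summable_norm hsum.norm), ← tsum_mul_left]
    refine tsum_congr fun T => ?_
    rw [absNorm_inf_primeInf, moebiusWeight]
    push_cast
    rw [mul_inv, mul_left_comm]
    congr 1
    rw [← Finset.prod_inv_distrib, ← Finset.prod_mul_distrib]
    refine Finset.prod_congr rfl fun v _ => ?_
    simp only [a]
    split_ifs <;> simp
  rw [hprod, ← Real.rexp_tsum_eq_tprod hpos (Real.summable_log_one_add_of_summable hsum)]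
  have : (0 : ℝ) < Ideal.absNorm Λ := by exact_mod_cast absNorm_pos hΛ
  positivity

theorem sqrt_prod_le_norm_generator (h2 : Module.finrank ℚ K = 2) (σ : K →+* ℂ)
    {Λ : Ideal (𝓞 K)} (hΛ : Λ ≠ ⊥) (T : Finset (HeightOneSpectrum (𝓞 K))) :
    ∏ v ∈ T, Real.sqrt (Ideal.absNorm v.asIdeal) ≤
      ‖σ (idealGen (Λ ⊓ primeInf T))‖ := by
  classical
  refine le_of_sq_le_sq ?_ (norm_nonneg _)
  rw [norm_generator_sq h2 σ, ← Finset.prod_pow]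
  have : ∏ v ∈ T, Real.sqrt (Ideal.absNorm v.asIdeal) ^ 2 = (Ideal.absNorm (primeInf T) : ℝ) := by
    rw [absNorm_primeInf]
    push_cast
    exact Finset.prod_congr rfl fun v _ => Real.sq_sqrt (by positivity)
  rw [this]
  exact_mod_cast Nat.le_of_dvd (absNorm_pos (inf_primeInf_ne_bot hΛ T)) (Ideal.absNorm_dvd_absNorm_of_le inf_le_right)

end PrimeSums

/-! ### Sums of the Euler function over an ideal -/

section TotientSums

variable {K : Type*} [Field K]

/-- Multiplication by the generator parametrises `I`. The origin, absent from `s` but allowed in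
`t`, has weight zero. -/
theorem sum_mem_inf_eq [IsPrincipalIdealRing (𝓞 K)] (σ : K →+* ℂ) (g : ℂ → ℂ) (N : ℝ) (I : Ideal (𝓞 K)) (hI : I ≠ ⊥)
    (s t : Finset (𝓞 K)) (hs : ∀ m, m ∈ s ↔ m ∈ I ∧ m ≠ 0 ∧ ‖σ m‖ ≤ N)
    (ht : ∀ x, x ∈ t ↔ ‖σ (idealGen I) * σ x‖ ≤ N) :
    ∑ m ∈ s, ((‖σ m‖ ^ 2 : ℝ) : ℂ) * g (σ m) =
      ∑ x ∈ t, ((‖σ (idealGen I) * σ x‖ ^ 2 : ℝ) : ℂ) * g (σ (idealGen I) * σ x) := by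
  classical
  have ha : idealGen I ≠ 0 := fun h => hI (by
    rw [← span_idealGen I, h, Ideal.span_singleton_eq_bot])
  have hmul (x : 𝓞 K) : σ (idealGen I) * σ x = σ ((idealGen I * x : 𝓞 K) : K) := by
    rw [← map_mul]; rfl
  have hst : s = (t.erase 0).image fun x => idealGen I * x := by
    ext m
    simp only [hs, Finset.mem_image, Finset.mem_erase, ht, hmul]
    constructor
    · rintro ⟨hmI, hm0, hmN⟩
      rw [← span_idealGen I, Ideal.mem_span_singleton] at hmI
      obtain ⟨x, rfl⟩ := hmI
      exact ⟨x, ⟨right_ne_zero_of_mul hm0, hmN⟩, rfl⟩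
    · rintro ⟨x, ⟨hx0, hxN⟩, rfl⟩
      refine ⟨?_, mul_ne_zero ha hx0, hxN⟩
      exact (span_idealGen I).le (Ideal.mem_span_singleton.mpr (dvd_mul_right _ _))
  rw [hst, Finset.sum_image (fun x _ y _ h => mul_left_cancel₀ ha h)]
  simp only [hmul]
  by_cases h0 : (0 : 𝓞 K) ∈ t
  · rw [← Finset.add_sum_erase t _ h0]; simp
  · rw [Finset.erase_eq_of_notMem h0]

variable [NumberField K]

/-- Here the index set no longer depends on `a`, so that the sum over `T` can be exchanged with a
sum over `a`. -/
theorem hasSum_eulerPhi {a : 𝓞 K} (ha : a ≠ 0) :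
    haveI := Classical.decPred fun T : Finset (HeightOneSpectrum (𝓞 K)) => a ∈ primeInf T
    HasSum (fun T : Finset (HeightOneSpectrum (𝓞 K)) =>
      if a ∈ primeInf T then (Ideal.absNorm (Ideal.span {a}) : ℝ) * moebiusWeight T else 0)
      (eulerPhi a : ℝ) := by
  classical
  have hm (T : Finset (HeightOneSpectrum (𝓞 K))) :
      T ∈ (finite_primes_mem ha).toFinset.powerset ↔ a ∈ primeInf T := by
    rw [Finset.mem_powerset, mem_primeInf]
    exact forall₂_congr fun v _ => by simp
  rw [eulerPhi_eq_sum ha, Finset.sum_congr rfl fun T hT => (if_pos ((hm T).mp hT)).symm]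
  exact hasSum_sum_of_ne_finset_zero fun T hT => if_neg fun h => hT ((hm T).mpr h)

theorem abs_moebiusWeight (T : Finset (HeightOneSpectrum (𝓞 K))) :
    |moebiusWeight T| = ∏ v ∈ T, (Ideal.absNorm v.asIdeal : ℝ)⁻¹ := by
  rw [moebiusWeight, Finset.abs_prod]
  refine Finset.prod_congr rfl fun v _ => ?_
  rw [abs_neg, abs_of_nonneg (by positivity)]

variable [NumberField.IsTotallyComplex K]

theorem exists_card_bound (h2 : Module.finrank ℚ K = 2) (σ : K →+* ℂ) :
    ∃ C : ℝ, 0 < C ∧ ∀ N : ℝ, 1 ≤ N → ∀ s : Finset (𝓞 K), (∀ m ∈ s, ‖σ m‖ ≤ N) →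
      (s.card : ℝ) ≤ C * N ^ 2 := by
  obtain ⟨P, D, hP⟩ := exists_isCell h2 σ
  have hD := hP.pos
  have hV := hP.area_pos
  have hπ := Real.pi_pos
  refine ⟨2 * Real.pi * (1 + D) ^ 2 / volume.real P, by positivity, fun N hN s hs => ?_⟩
  have hf := finite_norm_le h2 σ N
  have h := hP.card_le hN hf.toFinset (fun x => by simp)
  have hle : s.card ≤ hf.toFinset.card := Finset.card_le_card fun x hx => by simpa using hs x hx
  have hle' : (s.card : ℝ) ≤ hf.toFinset.card := by exact_mod_cast hle
  rw [div_mul_eq_mul_div, le_div_iff₀ hV]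
  nlinarith

variable [IsPrincipalIdealRing (𝓞 K)]

/-- Each prime gives `N(v)⁻¹` from the weight and at most `N(v)^(-1/2)` from the generator. This
majorant makes the total error converge. -/
theorem abs_moebiusWeight_mul_inv_norm_le (h2 : Module.finrank ℚ K = 2) (σ : K →+* ℂ)
    {Λ : Ideal (𝓞 K)} (hΛ : Λ ≠ ⊥) (T : Finset (HeightOneSpectrum (𝓞 K))) :
    |moebiusWeight T| * ‖σ (idealGen (Λ ⊓ primeInf T))‖⁻¹ ≤
      ∏ v ∈ T, (Real.sqrt (Ideal.absNorm v.asIdeal))⁻¹ ^ 3 := by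
  have h := sqrt_prod_le_norm_generator h2 σ hΛ T
  have hpos : 0 < ∏ v ∈ T, Real.sqrt (Ideal.absNorm v.asIdeal) := Finset.prod_pos fun v _ =>
    Real.sqrt_pos.mpr (by exact_mod_cast absNorm_pos v.ne_bot)
  have e : ∏ v ∈ T, (Real.sqrt (Ideal.absNorm v.asIdeal))⁻¹ ^ 3 =
      |moebiusWeight T| * (∏ v ∈ T, Real.sqrt (Ideal.absNorm v.asIdeal))⁻¹ := by
    rw [abs_moebiusWeight, ← Finset.prod_inv_distrib, ← Finset.prod_mul_distrib]
    refine Finset.prod_congr rfl fun v _ => ?_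
    rw [pow_succ, inv_pow, Real.sq_sqrt (by positivity)]
  rw [e]
  gcongr

/-- The weighted sums of `φ_K` over the elements of `Λ` in a disc. -/
theorem exists_totient_sum_bound (h2 : Module.finrank ℚ K = 2) (σ : K →+* ℂ)
    {Λ : Ideal (𝓞 K)} (hΛ : Λ ≠ ⊥) :
    ∃ c C : ℝ, 0 < c ∧ 0 < C ∧ ∀ (g : ℂ → ℂ) (B ℓ ε : ℝ), IsApproxLip g B ℓ ε → ∀ N : ℝ, 0 < N →
      ∀ s : Finset (𝓞 K), (∀ m, m ∈ s ↔ m ∈ Λ ∧ m ≠ 0 ∧ ‖σ m‖ ≤ N) →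
      ‖∑ m ∈ s, (eulerPhi m : ℂ) * g (σ m) - c * discIntegral N g‖
        ≤ C * ((ℓ * N + B) * N ^ 3 + ε * N ^ 4) := by
  classical
  obtain ⟨P, D, hP⟩ := exists_isCell h2 σ
  have hD := hP.pos
  have hV := hP.area_pos
  have hπ := Real.pi_pos
  set W : Finset (HeightOneSpectrum (𝓞 K)) → ℝ := fun T =>
    ∏ v ∈ T, (Real.sqrt (Ideal.absNorm v.asIdeal))⁻¹ ^ 3 with hW
  have hWs : Summable W := summable_finsetProd_of_summable_nonneg (fun v => by positivity)
    (summable_absNorm_rpow h2 σ)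
  have hW0 : ∀ T, 0 ≤ W T := fun T => Finset.prod_nonneg fun v _ => by positivity
  have hWt : 0 ≤ ∑' T, W T := tsum_nonneg hW0
  have hWpos : 0 < 1 + ∑' T, W T := by linarith
  have hwW := abs_moebiusWeight_mul_inv_norm_le h2 σ hΛ
  let a : Finset (HeightOneSpectrum (𝓞 K)) → ℂ := fun T => σ (idealGen (Λ ⊓ primeInf T))
  have hgen0 (T) : idealGen (Λ ⊓ primeInf T) ≠ 0 := fun h => inf_primeInf_ne_bot hΛ T (by
    rw [← span_idealGen (Λ ⊓ primeInf T), h, Ideal.span_singleton_eq_bot])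
  have ha1 (T) : 1 ≤ ‖a T‖ := one_le_norm h2 σ (hgen0 T)
  have ha0 (T) : a T ≠ 0 := norm_pos_iff.mp (by linarith [ha1 T])
  have haN (T) : (Ideal.absNorm (Λ ⊓ primeInf T) : ℝ) = ‖a T‖ ^ 2 := (norm_generator_sq h2 σ _).symm
  have hinv (T) : (‖a T‖ ^ 2)⁻¹ ≤ ‖a T‖⁻¹ :=
    inv_anti₀ (by linarith [ha1 T]) (by nlinarith [ha1 T])
  have hmean : HasSum (fun T => moebiusWeight T * (‖a T‖ ^ 2)⁻¹) (meanDensity Λ) := by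
    simp_rw [← haN]
    refine Summable.hasSum (hWs.of_norm_bounded fun T => ?_)
    rw [haN, norm_mul, Real.norm_eq_abs, Real.norm_of_nonneg (by positivity)]
    exact (mul_le_mul_of_nonneg_left (hinv T) (abs_nonneg _)).trans (hwW T)
  set C₀ := 8 * Real.pi * (1 + D) ^ 3 with hC₀
  refine ⟨meanDensity Λ / volume.real P, C₀ * (1 + ∑' T, W T) / volume.real P,
    div_pos (meanDensity_pos h2 σ hΛ) hV, by positivity, ?_⟩
  intro g B ℓ ε hg N hN s hs
  have hB := hg.bound_nonneg
  have hℓ := hg.lip_nonneg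
  have hε := hg.err_nonneg
  have ht (T) : ∃ t : Finset (𝓞 K), ∀ x, x ∈ t ↔ ‖a T * σ x‖ ≤ N := by
    have hf := finite_norm_le h2 σ (N / ‖a T‖)
    refine ⟨hf.toFinset, fun x => ?_⟩
    rw [Set.Finite.mem_toFinset, Set.mem_ofPred_eq, norm_mul,
      le_div_iff₀ (norm_pos_iff.mpr (ha0 T)), mul_comm]
  choose t ht using ht
  let S : Finset (HeightOneSpectrum (𝓞 K)) → ℂ := fun T =>
    ∑ x ∈ t T, ((‖a T * σ x‖ ^ 2 : ℝ) : ℂ) * g (a T * σ x)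
  -- For fixed `T`, the elements of `Λ` that contribute are those of `Λ ⊓ primeInf T`, that is, the
  -- multiples of `a T`.
  have hsum1 : HasSum (fun T => (moebiusWeight T : ℂ) * S T)
      (∑ m ∈ s, (eulerPhi m : ℂ) * g (σ m)) := by
    have h1 : HasSum (fun T => ∑ m ∈ s, (((if m ∈ primeInf T then
        (Ideal.absNorm (Ideal.span {m}) : ℝ) * moebiusWeight T else 0 : ℝ)) : ℂ) * g (σ m))
        (∑ m ∈ s, (eulerPhi m : ℂ) * g (σ m)) := by
      refine hasSum_sum fun m hm => ?_
      have := hasSum_eulerPhi ((hs m).mp hm).2.1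
      have h' := (Complex.hasSum_ofReal.mpr this).mul_right (g (σ m))
      simpa using h'
    refine h1.congr_fun fun T => ?_
    have hST : S T = _ := (sum_mem_inf_eq σ g N (Λ ⊓ primeInf T) (inf_primeInf_ne_bot hΛ T)
      (s.filter fun m => m ∈ primeInf T) (t T) (fun m => ?_) (ht T)).symm
    rw [hST, Finset.mul_sum, Finset.sum_filter]
    · refine Finset.sum_congr rfl fun m _ => ?_
      split_ifs
      · rw [norm_sq_eq_absNorm h2 σ]; push_cast; ring
      · simp
    · rw [Finset.mem_filter, hs, Ideal.mem_inf]
      tauto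
  have hsum2 := (hsum1.mul_left (volume.real P : ℂ)).sub
    ((Complex.hasSum_ofReal.mpr hmean).mul_right (discIntegral N g))
  have hX : 0 ≤ (ℓ * N + B) * N ^ 3 + ε * N ^ 4 := by positivity
  have hbd := hsum2.norm_le_of_bounded
    (hWs.hasSum.mul_right (C₀ * ((ℓ * N + B) * N ^ 3 + ε * N ^ 4))) (fun T => by
      have key := hP.norm_sum_mul_sub_discIntegral_le (fun x hx => one_le_norm h2 σ hx) hg hN
        (ha0 T) (t T) (ht T)
      have e : (volume.real P : ℂ) * ((moebiusWeight T : ℂ) * S T) -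
          ((moebiusWeight T * (‖a T‖ ^ 2)⁻¹ : ℝ) : ℂ) * discIntegral N g =
          (moebiusWeight T : ℂ) * ((volume.real P : ℂ) * S T
            - ((‖a T‖ ^ 2 : ℝ) : ℂ)⁻¹ * discIntegral N g) := by
        push_cast; ring
      rw [e, norm_mul, Complex.norm_real, Real.norm_eq_abs]
      calc |moebiusWeight T| * _ ≤ |moebiusWeight T| * (C₀ * ((ℓ * N + B) * N ^ 3 / ‖a T‖
            + ε * N ^ 4 / ‖a T‖ ^ 2)) := mul_le_mul_of_nonneg_left key (abs_nonneg _)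
        -- The `ε` term has `‖a T‖ ^ 2` in the denominator; as `1 ≤ ‖a T‖`, one power suffices and
        -- `W` majorises both terms.
        _ ≤ |moebiusWeight T| * (C₀ * ((ℓ * N + B) * N ^ 3 * ‖a T‖⁻¹
            + ε * N ^ 4 * ‖a T‖⁻¹)) := by
          rw [div_eq_mul_inv, div_eq_mul_inv]
          have := hinv T
          gcongr
        _ = (|moebiusWeight T| * ‖a T‖⁻¹) * (C₀ * ((ℓ * N + B) * N ^ 3 + ε * N ^ 4)) := by ring
        _ ≤ W T * (C₀ * ((ℓ * N + B) * N ^ 3 + ε * N ^ 4)) :=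
          mul_le_mul_of_nonneg_right (hwW T) (by positivity))
  have e : ∑ m ∈ s, (eulerPhi m : ℂ) * g (σ m)
      - ((meanDensity Λ / volume.real P : ℝ) : ℂ) * discIntegral N g =
      (volume.real P : ℂ)⁻¹ * ((volume.real P : ℂ) * ∑ m ∈ s, (eulerPhi m : ℂ) * g (σ m)
        - (meanDensity Λ : ℂ) * discIntegral N g) := by
    have : (volume.real P : ℂ) ≠ 0 := by exact_mod_cast hV.ne'
    push_cast
    field_simp
  rw [e, norm_mul, norm_inv, Complex.norm_real, Real.norm_of_nonneg hV.le]
  calc (volume.real P)⁻¹ * _ ≤ (volume.real P)⁻¹ *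
        ((∑' T, W T) * (C₀ * ((ℓ * N + B) * N ^ 3 + ε * N ^ 4))) := by gcongr
    _ ≤ (volume.real P)⁻¹ *
        ((1 + ∑' T, W T) * (C₀ * ((ℓ * N + B) * N ^ 3 + ε * N ^ 4))) := by
        gcongr
        linarith
    _ = _ := by ring

end TotientSums

/-! ### Pair sums against a double integral -/

/-- The double integral `∫∫ |w|² |z|² g(z / w)` over the square of the disc of radius `N`. -/
def quotientIntegral (N : ℝ) (g : ℂ → ℂ) : ℂ :=
  discIntegral N fun w => discIntegral N fun z => g (w⁻¹ * z)

theorem measurable_discIntegral_quotient {g : ℂ → ℂ} (hg : Continuous g) (N : ℝ) :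
    Measurable fun w : ℂ => discIntegral N fun z => g (w⁻¹ * z) := by
  have hm : Measurable fun p : ℂ × ℂ => ((‖p.2‖ ^ 2 : ℝ) : ℂ) * g (p.1⁻¹ * p.2) := by
    have := hg.measurable
    fun_prop
  exact (hm.stronglyMeasurable.integral_prod_right
    (ν := volume.restrict (Metric.closedBall (0 : ℂ) N))).measurable

theorem integrableOn_closedBall_of_bound {F : Type*} [NormedAddCommGroup F] {f : ℂ → F}
    (hf : AEStronglyMeasurable f) {N C : ℝ} (hC : ∀ z, ‖z‖ ≤ N → ‖f z‖ ≤ C) :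
    IntegrableOn f (Metric.closedBall 0 N) := by
  refine IntegrableOn.of_bound measure_closedBall_lt_top hf.restrict C ?_
  refine (ae_restrict_iff' Metric.isClosed_closedBall.measurableSet).mpr (ae_of_all _ fun z hz => ?_)
  exact hC z (by simpa using hz)

section PairSums

variable {K : Type*} [Field K] [NumberField K] [NumberField.IsTotallyComplex K]

/-- Dividing the variable by a point of modulus `x` multiplies the Lipschitz constant by `x⁻¹`,
which is large for small `x`; the weight `x ^ 2` compensates. -/
theorem sq_mul_bound {x N ℓ B ε C : ℝ} (hx0 : 0 < x) (hx : x ≤ N) (hℓ : 0 ≤ ℓ) (hB : 0 ≤ B)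
    (hε : 0 ≤ ε) (hC : 0 ≤ C) :
    x ^ 2 * (C * ((ℓ * x⁻¹ * N + B) * N ^ 3 + ε * N ^ 4)) ≤
      C * ((ℓ + B) * N ^ 5 + ε * N ^ 6) := by
  have hN : 0 < N := hx0.trans_le hx
  have e : x ^ 2 * (C * ((ℓ * x⁻¹ * N + B) * N ^ 3 + ε * N ^ 4)) =
      C * ((ℓ * x * N + B * x ^ 2) * N ^ 3 + ε * x ^ 2 * N ^ 4) := by
    field_simp
  rw [e]
  calc C * ((ℓ * x * N + B * x ^ 2) * N ^ 3 + ε * x ^ 2 * N ^ 4)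
      ≤ C * ((ℓ * N * N + B * N ^ 2) * N ^ 3 + ε * N ^ 2 * N ^ 4) := by gcongr
    _ = _ := by ring

/-- The weighted pair sums of a function of the quotient, against the double integral. -/
theorem exists_pair_sum_bound (h2 : Module.finrank ℚ K = 2) (σ : K →+* ℂ)
    {Λ : Ideal (𝓞 K)} {c C₁ : ℝ} (hc : 0 < c) (hC₁ : 0 < C₁)
    (hsum : ∀ (g : ℂ → ℂ) (B ℓ ε : ℝ), IsApproxLip g B ℓ ε → ∀ N : ℝ, 0 < N →
      ∀ s : Finset (𝓞 K), (∀ m, m ∈ s ↔ m ∈ Λ ∧ m ≠ 0 ∧ ‖σ m‖ ≤ N) →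
      ‖∑ m ∈ s, (eulerPhi m : ℂ) * g (σ m) - c * discIntegral N g‖
        ≤ C₁ * ((ℓ * N + B) * N ^ 3 + ε * N ^ 4)) :
    ∃ C : ℝ, 0 < C ∧ ∀ (g g' : ℂ → ℂ) (B ℓ ε : ℝ), IsApproxLip g B ℓ ε → IsApproxLip g' B ℓ ε →
      (∀ u, g' u⁻¹ = g u) → ∀ N : ℝ, 1 ≤ N →
      ∀ s : Finset (𝓞 K), (∀ m, m ∈ s ↔ m ∈ Λ ∧ m ≠ 0 ∧ ‖σ m‖ ≤ N) →
      ‖∑ m ∈ s, ∑ n ∈ s, (eulerPhi m : ℂ) * eulerPhi n * g (σ m / σ n)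
        - c ^ 2 * quotientIntegral N g‖ ≤ C * ((ℓ + B) * N ^ 7 + ε * N ^ 8) := by
  obtain ⟨C₂, hC₂, hcard⟩ := exists_card_bound h2 σ
  have hπ := Real.pi_pos
  refine ⟨C₁ * C₂ + c * C₁ * Real.pi, by positivity, ?_⟩
  intro g g' B ℓ ε hg hg' hgg N hN s hs
  have hN0 : 0 < N := by linarith
  have hB := hg.bound_nonneg
  have hℓ := hg.lip_nonneg
  have hε := hg.err_nonneg
  have hphi : ∀ m ∈ s, (eulerPhi m : ℝ) ≤ ‖σ m‖ ^ 2 := fun m hm => by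
    rw [norm_sq_eq_absNorm h2 σ]
    exact_mod_cast eulerPhi_le m ((hs m).mp hm).2.1
  have hpos : ∀ m ∈ s, 0 < ‖σ m‖ := fun m hm => by
    linarith [one_le_norm h2 σ ((hs m).mp hm).2.1]
  set X := (ℓ + B) * N ^ 5 + ε * N ^ 6 with hX
  have hX0 : 0 ≤ X := by positivity
  -- The sum over `n` is replaced by an integral with `m` fixed. Since `g (m / n) = g' (n / m)`, it
  -- is the function `g'` that depends on `n` linearly.
  have step1 : ‖∑ m ∈ s, ∑ n ∈ s, (eulerPhi m : ℂ) * eulerPhi n * g (σ m / σ n)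
      - c * ∑ m ∈ s, (eulerPhi m : ℂ) * discIntegral N (fun w => g' ((σ m)⁻¹ * w))‖
      ≤ C₁ * C₂ * (N ^ 2 * X) := by
    rw [Finset.mul_sum, ← Finset.sum_sub_distrib]
    have hterm : ∀ m ∈ s, ‖∑ n ∈ s, (eulerPhi m : ℂ) * eulerPhi n * g (σ m / σ n)
        - c * ((eulerPhi m : ℂ) * discIntegral N (fun w => g' ((σ m)⁻¹ * w)))‖ ≤ C₁ * X := by
      intro m hm
      have key := hsum _ _ _ _ (hg'.comp_mul_left (σ m)⁻¹) N hN0 s hs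
      have e : ∑ n ∈ s, (eulerPhi m : ℂ) * eulerPhi n * g (σ m / σ n)
          - c * ((eulerPhi m : ℂ) * discIntegral N (fun w => g' ((σ m)⁻¹ * w))) =
          (eulerPhi m : ℂ) * (∑ n ∈ s, (eulerPhi n : ℂ) * g' ((σ m)⁻¹ * σ n)
            - c * discIntegral N (fun w => g' ((σ m)⁻¹ * w))) := by
        rw [mul_sub, Finset.mul_sum]
        congr 1
        · refine Finset.sum_congr rfl fun n _ => ?_
          rw [← hgg (σ m / σ n), inv_div, div_eq_inv_mul, mul_assoc]
        · ring
      rw [e, norm_mul, Complex.norm_natCast]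
      rw [norm_inv] at key
      calc (eulerPhi m : ℝ) * _ ≤ ‖σ m‖ ^ 2 *
          (C₁ * ((ℓ * ‖σ m‖⁻¹ * N + B) * N ^ 3 + ε * N ^ 4)) := by
            gcongr
            exact hphi m hm
        _ ≤ C₁ * X := sq_mul_bound (hpos m hm) ((hs m).mp hm).2.2 hℓ hB hε hC₁.le
    refine (norm_sum_le_of_le s hterm).trans ?_
    rw [Finset.sum_const, nsmul_eq_mul]
    have := hcard N hN s fun m hm => ((hs m).mp hm).2.2
    calc (s.card : ℝ) * (C₁ * X) ≤ C₂ * N ^ 2 * (C₁ * X) := by gcongr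
      _ = _ := by ring
  have hi1 (m : 𝓞 K) : IntegrableOn
      (fun w => ((‖w‖ ^ 2 : ℝ) : ℂ) * g' ((σ m)⁻¹ * w)) (Metric.closedBall 0 N) :=
    (hg'.comp_mul_left (σ m)⁻¹).integrableOn N
  have hswap : ∑ m ∈ s, (eulerPhi m : ℂ) * discIntegral N (fun w => g' ((σ m)⁻¹ * w)) =
      discIntegral N fun w => ∑ m ∈ s, (eulerPhi m : ℂ) * g' ((σ m)⁻¹ * w) := by
    simp only [discIntegral, ← integral_const_mul]
    rw [← integral_finsetSum _ fun m _ => (hi1 m).const_mul _]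
    refine integral_congr_ae (ae_of_all _ fun w => ?_)
    simp only [Finset.mul_sum]
    exact Finset.sum_congr rfl fun m _ => by ring
  -- With the sum over `m` moved inside the integral in `w`, the same estimate applies to `g (w⁻¹ *
  -- ·)` for each fixed `w ≠ 0`.
  have step2 : ‖∑ m ∈ s, (eulerPhi m : ℂ) * discIntegral N (fun w => g' ((σ m)⁻¹ * w))
      - c * quotientIntegral N g‖ ≤ C₁ * Real.pi * (N ^ 2 * X) := by
    rw [hswap, quotientIntegral, discIntegral, discIntegral, ← integral_const_mul,
      ← integral_sub]
    · have hb := norm_setIntegral_le_of_norm_le_const (μ := volume)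
        (s := Metric.closedBall (0 : ℂ) N)
        (f := fun w => ((‖w‖ ^ 2 : ℝ) : ℂ) * (∑ m ∈ s, (eulerPhi m : ℂ) * g' ((σ m)⁻¹ * w))
          - c * (((‖w‖ ^ 2 : ℝ) : ℂ) * discIntegral N fun z => g (w⁻¹ * z)))
        (C := C₁ * X) measure_closedBall_lt_top (fun w hw => by
          rw [mem_closedBall_zero_iff] at hw
          rcases eq_or_ne w 0 with rfl | hw0
          · simp; positivity
          have key := hsum _ _ _ _ (hg.comp_mul_left w⁻¹) N hN0 s hs
          have e : ((‖w‖ ^ 2 : ℝ) : ℂ) * (∑ m ∈ s, (eulerPhi m : ℂ) * g' ((σ m)⁻¹ * w))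
              - c * (((‖w‖ ^ 2 : ℝ) : ℂ) * discIntegral N fun z => g (w⁻¹ * z)) =
              ((‖w‖ ^ 2 : ℝ) : ℂ) * (∑ m ∈ s, (eulerPhi m : ℂ) * g (w⁻¹ * σ m)
                - c * discIntegral N fun z => g (w⁻¹ * z)) := by
            rw [mul_sub]
            congr 1
            · congr 1
              refine Finset.sum_congr rfl fun m _ => ?_
              rw [← hgg (w⁻¹ * σ m), mul_inv, inv_inv, mul_comm w]
            · ring
          rw [e, norm_mul, Complex.norm_real, Real.norm_of_nonneg (by positivity)]
          rw [norm_inv] at key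
          refine (mul_le_mul_of_nonneg_left key (by positivity)).trans ?_
          exact sq_mul_bound (norm_pos_iff.mpr hw0) hw hℓ hB hε hC₁.le)
      refine hb.trans (le_of_eq ?_)
      rw [volume_real_closedBall, max_eq_left hN0.le]
      ring
    · have : (fun w => ((‖w‖ ^ 2 : ℝ) : ℂ) * ∑ m ∈ s, (eulerPhi m : ℂ) * g' ((σ m)⁻¹ * w)) =
          fun w => ∑ m ∈ s, (eulerPhi m : ℂ) * (((‖w‖ ^ 2 : ℝ) : ℂ) * g' ((σ m)⁻¹ * w)) := by
        ext w
        rw [Finset.mul_sum]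
        exact Finset.sum_congr rfl fun m _ => by ring
      rw [this]
      exact integrable_finsetSum _ fun m _ => (hi1 m).const_mul _
    · refine Integrable.const_mul ?_ _
      refine integrableOn_closedBall_of_bound (C := N ^ 2 * (Real.pi * B * N ^ 4)) ?_ fun w hw => ?_
      · have := measurable_discIntegral_quotient hg.continuous N
        have h3 : Measurable fun w : ℂ => ((‖w‖ ^ 2 : ℝ) : ℂ) := by fun_prop
        exact (h3.mul this).aestronglyMeasurable
      · rw [norm_mul, Complex.norm_real, Real.norm_of_nonneg (by positivity)]
        have := norm_discIntegral_le (fun z => hg.norm_le (w⁻¹ * z)) hN0.le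
        gcongr
  have e : ∑ m ∈ s, ∑ n ∈ s, (eulerPhi m : ℂ) * eulerPhi n * g (σ m / σ n)
        - c ^ 2 * quotientIntegral N g =
      (∑ m ∈ s, ∑ n ∈ s, (eulerPhi m : ℂ) * eulerPhi n * g (σ m / σ n)
      - c * ∑ m ∈ s, (eulerPhi m : ℂ) * discIntegral N (fun w => g' ((σ m)⁻¹ * w))) +
      c * (∑ m ∈ s, (eulerPhi m : ℂ) * discIntegral N (fun w => g' ((σ m)⁻¹ * w))
      - c * quotientIntegral N g) := by ring
  rw [e]
  refine (norm_add_le _ _).trans ?_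
  rw [norm_mul, Complex.norm_real, Real.norm_of_nonneg hc.le]
  calc _ ≤ C₁ * C₂ * (N ^ 2 * X) + c * (C₁ * Real.pi * (N ^ 2 * X)) := by gcongr
    _ = _ := by rw [hX]; ring

end PairSums

/-! ### Evaluation of the double integral -/

theorem setIntegral_norm_pow (k : ℕ) {r : ℝ} (hr : 0 ≤ r) :
    ∫ w in Metric.closedBall (0 : ℂ) r, ((‖w‖ ^ k : ℝ) : ℂ) =
      ((2 * Real.pi * r ^ (k + 2) / (k + 2) : ℝ) : ℂ) := by
  rw [integral_complex_ofReal]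
  congr 1
  rw [← integral_indicator Metric.isClosed_closedBall.measurableSet]
  have h := integral_fun_norm_addHaar (volume : Measure ℂ) ((Set.Iic r).indicator fun y : ℝ => y ^ k)
  have e : (fun w : ℂ => (Set.Iic r).indicator (fun y : ℝ => y ^ k) ‖w‖) =
      (Metric.closedBall (0 : ℂ) r).indicator fun w => ‖w‖ ^ k := by
    ext w
    simp [Set.indicator]
  rw [← e, h, Complex.finrank_real_complex, volume_real_ball]
  have e2 : ∫ y in Set.Ioi (0 : ℝ), y ^ (2 - 1) • (Set.Iic r).indicator (fun y : ℝ => y ^ k) y =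
      r ^ (k + 2) / (k + 2) := by
    have : (fun y : ℝ => y ^ (2 - 1) • (Set.Iic r).indicator (fun y : ℝ => y ^ k) y) =
        (Set.Iic r).indicator fun y : ℝ => y ^ (k + 1) := by
      ext y
      by_cases hy : y ∈ Set.Iic r <;> simp [hy, pow_succ, mul_comm]
    rw [this, setIntegral_indicator measurableSet_Iic, Set.Ioi_inter_Iic,
      ← intervalIntegral.integral_of_le hr, integral_pow]
    push_cast
    simp
    ring
  rw [e2]
  simp
  ring

theorem discIntegral_one {N : ℝ} (hN : 0 ≤ N) :
    discIntegral N (fun _ => 1) = ((Real.pi / 2 * N ^ 4 : ℝ) : ℂ) := by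
  simp only [discIntegral, mul_one]
  rw [setIntegral_norm_pow 2 hN]
  congr 1
  push_cast
  ring

/-- Substituting `z = w u` gives the weight `|w|⁶ |u|²`. After exchanging the integrals, `w` ranges
over the disc of radius `N * min 1 ‖u‖⁻¹`, and the integral of `|w|⁶` over a disc of radius `r` is
`(π / 4) r⁸`. -/
theorem quotientIntegral_eq {g : ℂ → ℂ} (hg : Continuous g) {R : ℝ}
    (hR : ∀ u, R < ‖u‖ → g u = 0) {N : ℝ} (hN : 0 < N) :
    quotientIntegral N g = ((Real.pi / 4 * N ^ 8 : ℝ) : ℂ) *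
      ∫ u, ((‖u‖ ^ 2 * (min 1 ‖u‖⁻¹) ^ 8 : ℝ) : ℂ) * g u := by
  let G : ℂ × ℂ → ℂ := fun p => ((‖p.1‖ ^ 6 * ‖p.2‖ ^ 2 : ℝ) : ℂ) * g p.2
  -- The condition `‖p.2‖ ≤ R` loses nothing, as `g` vanishes beyond `R`, and makes the domain
  -- bounded, which gives the integrability needed for Fubini.
  let S : Set (ℂ × ℂ) := {p | ‖p.1‖ ≤ N ∧ ‖p.1‖ * ‖p.2‖ ≤ N ∧ ‖p.2‖ ≤ R}
  have hSm : MeasurableSet S := by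
    apply IsClosed.measurableSet
    have h1 : IsClosed {p : ℂ × ℂ | ‖p.1‖ ≤ N} := isClosed_le (by fun_prop) (by fun_prop)
    have h2 : IsClosed {p : ℂ × ℂ | ‖p.1‖ * ‖p.2‖ ≤ N} := isClosed_le (by fun_prop) (by fun_prop)
    have h3 : IsClosed {p : ℂ × ℂ | ‖p.2‖ ≤ R} := isClosed_le (by fun_prop) (by fun_prop)
    exact h1.inter (h2.inter h3)
  have hGc : Continuous G := by fun_prop
  have hF : Integrable (Function.uncurry fun w u => S.indicator G (w, u))
      ((volume : Measure ℂ).prod volume) := by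
    change Integrable (S.indicator G) _
    rw [integrable_indicator_iff hSm]
    refine (hGc.continuousOn.integrableOn_compact ((isCompact_closedBall (0 : ℂ) N).prod
      (isCompact_closedBall (0 : ℂ) R))).mono_set ?_
    rintro ⟨w, u⟩ ⟨h1, -, h3⟩
    exact ⟨by simpa using h1, by simpa using h3⟩
  have hswap := integral_integral_swap hF
  have hleft : ∫ w, ∫ u, S.indicator G (w, u) = quotientIntegral N g := by
    rw [quotientIntegral, discIntegral, ← integral_indicator Metric.isClosed_closedBall.measurableSet]
    refine integral_congr_ae ?_
    filter_upwards [compl_mem_ae_iff.mpr (measure_singleton (0 : ℂ))] with w hw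
    have hw0 : w ≠ 0 := hw
    have hwpos := norm_pos_iff.mpr hw0
    by_cases hwN : ‖w‖ ≤ N
    · rw [Set.indicator_of_mem (by simpa using hwN), discIntegral_comp_mul N _ hw0]
      simp only [inv_mul_cancel_left₀ hw0]
      rw [discIntegral, ← integral_indicator Metric.isClosed_closedBall.measurableSet,
        ← integral_const_mul, ← integral_const_mul]
      refine integral_congr_ae (ae_of_all _ fun u => ?_)
      by_cases hu : ‖u‖ ≤ N / ‖w‖
      · have hu' : ‖w‖ * ‖u‖ ≤ N := by rwa [le_div_iff₀ hwpos, mul_comm] at hu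
        simp only [Set.indicator_of_mem (show u ∈ Metric.closedBall (0 : ℂ) (N / ‖w‖) by
          simpa using hu)]
        by_cases huR : ‖u‖ ≤ R
        · rw [Set.indicator_of_mem (show (w, u) ∈ S from ⟨hwN, hu', huR⟩)]
          simp only [G]; push_cast; ring
        · rw [Set.indicator_of_notMem (fun h => huR h.2.2), hR u (not_le.mp huR)]
          simp
      · have hu' : ¬ ‖w‖ * ‖u‖ ≤ N := by rwa [le_div_iff₀ hwpos, mul_comm] at hu
        simp only [Set.indicator_of_notMem (show (w, u) ∉ S from fun h => hu' h.2.1), Set.indicator_of_notMem (show u ∉ Metric.closedBall (0 : ℂ) (N / ‖w‖) by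
          simpa using hu), mul_zero]
    · rw [Set.indicator_of_notMem (by simpa using hwN)]
      rw [show (fun u => S.indicator G (w, u)) = fun _ => 0 by
        ext u; exact Set.indicator_of_notMem (fun h => hwN h.1) _]
      simp
  rw [← hleft, hswap, ← integral_const_mul]
  refine integral_congr_ae ?_
  filter_upwards [compl_mem_ae_iff.mpr (measure_singleton (0 : ℂ))] with u hu
  have hu0 : u ≠ 0 := hu
  have hupos := norm_pos_iff.mpr hu0
  by_cases huR : ‖u‖ ≤ R
  · have hr : 0 ≤ N * min 1 ‖u‖⁻¹ := by positivity
    have hmem (w : ℂ) : w ∈ Metric.closedBall (0 : ℂ) (N * min 1 ‖u‖⁻¹) ↔ (w, u) ∈ S := by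
      rw [mem_closedBall_zero_iff, mul_min_of_nonneg _ _ hN.le, le_min_iff, mul_one,
        ← div_eq_mul_inv, le_div_iff₀ hupos]
      exact ⟨fun h => ⟨h.1, h.2, huR⟩, fun h => ⟨h.1, h.2.1⟩⟩
    have e : (fun w => S.indicator G (w, u)) = fun w => (((‖u‖ ^ 2 : ℝ) : ℂ) * g u) *
        (Metric.closedBall (0 : ℂ) (N * min 1 ‖u‖⁻¹)).indicator
          (fun w => ((‖w‖ ^ 6 : ℝ) : ℂ)) w := by
      ext w
      by_cases hw : (w, u) ∈ S
      · rw [Set.indicator_of_mem hw, Set.indicator_of_mem ((hmem w).mpr hw)]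
        simp only [G]; push_cast; ring
      · rw [Set.indicator_of_notMem hw, Set.indicator_of_notMem (fun h => hw ((hmem w).mp h))]
        simp
    rw [e, integral_const_mul, integral_indicator Metric.isClosed_closedBall.measurableSet,
      setIntegral_norm_pow 6 hr]
    push_cast
    ring
  · rw [hR u (not_le.mp huR), mul_zero, mul_zero]
    rw [show (fun w => S.indicator G (w, u)) = fun _ => 0 by
      ext w; exact Set.indicator_of_notMem (fun h => huR h.2.2) _]
    simp

/-- The exponential maps the strip bijectively onto the complement of the null set `{0}`, with real
Jacobian `|exp z|²`. -/
theorem integral_eq_integral_strip (h : ℂ → ℂ) :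
    ∫ u, h u = ∫ z in {z : ℂ | z.im ∈ Set.Ioc (-Real.pi) Real.pi},
      ((‖Complex.exp z‖ ^ 2 : ℝ) : ℂ) * h (Complex.exp z) := by
  have hs : MeasurableSet {z : ℂ | z.im ∈ Set.Ioc (-Real.pi) Real.pi} :=
    Complex.measurable_im measurableSet_Ioc
  have himg : Complex.exp '' {z : ℂ | z.im ∈ Set.Ioc (-Real.pi) Real.pi} = {0}ᶜ := by
    ext u
    constructor
    · rintro ⟨z, -, rfl⟩
      exact Complex.exp_ne_zero z
    · intro hu
      exact ⟨Complex.log u, ⟨Complex.neg_pi_lt_log_im u, Complex.log_im_le_pi u⟩,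
        Complex.exp_log hu⟩
  have hd : ∀ z ∈ {z : ℂ | z.im ∈ Set.Ioc (-Real.pi) Real.pi},
      HasFDerivWithinAt Complex.exp
        ((ContinuousLinearMap.toSpanSingleton ℂ (Complex.exp z)).restrictScalars ℝ)
        {z : ℂ | z.im ∈ Set.Ioc (-Real.pi) Real.pi} z := fun z _ =>
    ((Complex.hasDerivAt_exp z).hasFDerivAt.restrictScalars ℝ).hasFDerivWithinAt
  have hinj : Set.InjOn Complex.exp {z : ℂ | z.im ∈ Set.Ioc (-Real.pi) Real.pi} :=
    fun z hz w hw hzw => Complex.exp_inj_of_neg_pi_lt_of_le_pi hz.1 hz.2 hw.1 hw.2 hzw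
  have key := integral_image_eq_integral_abs_det_fderiv_smul volume hs hd hinj h
  rw [himg, restrict_compl_singleton] at key
  rw [key]
  refine setIntegral_congr_fun hs fun z _ => ?_
  have hdet : ((ContinuousLinearMap.toSpanSingleton ℂ (Complex.exp z)).restrictScalars ℝ).det =
      ‖Complex.exp z‖ ^ 2 := by
    rw [ContinuousLinearMap.det]
    change LinearMap.det ((LinearMap.toSpanSingleton ℂ ℂ (Complex.exp z)).restrictScalars ℝ) = _
    rw [LinearMap.det_restrictScalars, Algebra.norm_complex_apply, Complex.normSq_eq_norm_sq]
    simp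
  rw [hdet, abs_of_nonneg (by positivity), Complex.real_smul]

/-! ### Functions on the cylinder as functions on the plane -/

theorem toCylinder_eq_of_exp_eq {z w : ℂ} (h : Complex.exp z = Complex.exp w) :
    toCylinder z = toCylinder w := by
  obtain ⟨n, hn⟩ := Complex.exp_eq_exp_iff_exists_int.mp h
  refine QuotientAddGroup.eq.mpr (AddSubgroup.mem_zmultiples_iff.mpr ⟨-n, ?_⟩)
  rw [hn, zsmul_eq_mul]
  push_cast
  ring

theorem cylLog_exp (z : ℂ) : cylLog (Complex.exp z) = toCylinder z :=
  toCylinder_eq_of_exp_eq (Complex.exp_log (Complex.exp_ne_zero z))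

theorem cylLog_sub {z w : ℂ} (hz : z ≠ 0) (hw : w ≠ 0) :
    cylLog z - cylLog w = cylLog (z / w) := by
  have : cylLog z - cylLog w = toCylinder (Complex.log z - Complex.log w) := rfl
  rw [this]
  refine toCylinder_eq_of_exp_eq ?_
  rw [Complex.exp_sub, Complex.exp_log hz, Complex.exp_log hw, Complex.exp_log (div_ne_zero hz hw)]

theorem cylLog_inv {z : ℂ} (hz : z ≠ 0) : cylLog z⁻¹ = -cylLog z := by
  have : -cylLog z = toCylinder (-Complex.log z) := rfl
  rw [this]
  refine toCylinder_eq_of_exp_eq ?_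
  rw [Complex.exp_neg, Complex.exp_log hz, Complex.exp_log (inv_ne_zero hz)]

theorem continuous_toCylinder : Continuous toCylinder := continuous_quotient_mk'

@[simp] theorem cylRe_toCylinder (z : ℂ) : cylRe (toCylinder z) = z.re := rfl

theorem continuous_cylRe : Continuous cylRe :=
  Continuous.quotient_lift (f := fun z : ℂ => z.re) Complex.continuous_re _

theorem cylRe_cylLog (z : ℂ) : cylRe (cylLog z) = Real.log ‖z‖ := by
  rw [cylLog, cylRe_toCylinder, Complex.log_re]

/-- The function `f ∘ log` on `ℂ`, extended by `0` at the origin. -/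
def pullbackLog (f : Cylinder → ℂ) (z : ℂ) : ℂ := if z = 0 then 0 else f (cylLog z)

theorem pullbackLog_zero (f : Cylinder → ℂ) : pullbackLog f 0 = 0 := if_pos rfl

theorem pullbackLog_of_ne {f : Cylinder → ℂ} {z : ℂ} (hz : z ≠ 0) :
    pullbackLog f z = f (cylLog z) := if_neg hz

theorem pullbackLog_exp (f : Cylinder → ℂ) (z : ℂ) :
    pullbackLog f (Complex.exp z) = f (toCylinder z) := by
  rw [pullbackLog_of_ne (Complex.exp_ne_zero z), cylLog_exp]

theorem pullbackLog_neg (f : Cylinder → ℂ) (z : ℂ) :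
    pullbackLog (fun e => f (-e)) z⁻¹ = pullbackLog f z := by
  rcases eq_or_ne z 0 with rfl | hz
  · simp [pullbackLog_zero]
  · rw [pullbackLog_of_ne hz, pullbackLog_of_ne (inv_ne_zero hz), cylLog_inv hz, neg_neg]

/-- Near `z₀` the quotient `z / z₀` is close to `1`, away from the cut of the logarithm; regularity
at every nonzero point follows. -/
theorem pullbackLog_eq_branch (f : Cylinder → ℂ) {z₀ z : ℂ} (h₀ : z₀ ≠ 0) (hz : z ≠ 0) :
    pullbackLog f z = f (toCylinder (Complex.log (z / z₀) + Complex.log z₀)) := by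
  rw [pullbackLog_of_ne hz]
  congr 1
  refine toCylinder_eq_of_exp_eq ?_
  rw [Complex.exp_add, Complex.exp_log (div_ne_zero hz h₀), Complex.exp_log h₀, Complex.exp_log hz,
    div_mul_cancel₀ _ h₀]

theorem exists_cylRe_bound {f : Cylinder → ℂ} (hf : HasCompactSupport f) :
    ∃ A : ℝ, ∀ e, A < |cylRe e| → f e = 0 := by
  obtain ⟨A, hA⟩ := hf.isCompact.exists_bound_of_continuousOn continuous_cylRe.continuousOn
  refine ⟨A, fun e he => ?_⟩
  by_contra hne
  exact absurd (hA e (subset_tsupport f hne)) (not_le.mpr he)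

/-- The real part is bounded on the support. Vanishing near `0` makes the extension by zero as
regular as `f`; vanishing far away gives compact support. -/
theorem exists_pullbackLog_eq_zero {f : Cylinder → ℂ} (hf : HasCompactSupport f) :
    ∃ r R : ℝ, 0 < r ∧ (∀ z, ‖z‖ < r → pullbackLog f z = 0) ∧
      ∀ z, R < ‖z‖ → pullbackLog f z = 0 := by
  obtain ⟨A, hA⟩ := exists_cylRe_bound hf
  refine ⟨Real.exp (-A), Real.exp A, Real.exp_pos _, fun z hz => ?_, fun z hz => ?_⟩
  · rcases eq_or_ne z 0 with rfl | h0
    · exact pullbackLog_zero f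
    · rw [pullbackLog_of_ne h0]
      refine hA _ ?_
      rw [cylRe_cylLog]
      have := (Real.log_lt_iff_lt_exp (norm_pos_iff.mpr h0)).mpr hz
      exact lt_abs.mpr (Or.inr (by linarith))
  · have h0 : z ≠ 0 := norm_pos_iff.mp ((Real.exp_pos A).trans hz)
    rw [pullbackLog_of_ne h0]
    refine hA _ ?_
    rw [cylRe_cylLog]
    exact lt_abs.mpr (Or.inl ((Real.lt_log_iff_exp_lt (norm_pos_iff.mpr h0)).mpr hz))

theorem hasCompactSupport_pullbackLog {f : Cylinder → ℂ} (hf : HasCompactSupport f) :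
    HasCompactSupport (pullbackLog f) := by
  obtain ⟨r, R, -, -, hR⟩ := exists_pullbackLog_eq_zero hf
  refine HasCompactSupport.intro (isCompact_closedBall (0 : ℂ) R) fun z hz => hR z ?_
  simpa using hz

theorem eventuallyEq_branch (f : Cylinder → ℂ) {z₀ : ℂ} (h₀ : z₀ ≠ 0) :
    pullbackLog f =ᶠ[𝓝 z₀] fun z => f (toCylinder (Complex.log (z / z₀) + Complex.log z₀)) := by
  filter_upwards [isOpen_ne.mem_nhds h₀] with z hz
  exact pullbackLog_eq_branch f h₀ hz

theorem eventuallyEq_zero {f : Cylinder → ℂ} (hf : HasCompactSupport f) :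
    pullbackLog f =ᶠ[𝓝 0] fun _ => 0 := by
  obtain ⟨r, R, hr, h, -⟩ := exists_pullbackLog_eq_zero hf
  filter_upwards [Metric.ball_mem_nhds (0 : ℂ) hr] with z hz
  exact h z (by simpa using hz)

theorem continuous_pullbackLog {f : Cylinder → ℂ} (hc : Continuous f) (hf : HasCompactSupport f) :
    Continuous (pullbackLog f) := by
  rw [continuous_iff_continuousAt]
  intro z₀
  rcases eq_or_ne z₀ 0 with rfl | h₀
  · exact (continuousAt_const (y := (0 : ℂ))).congr (eventuallyEq_zero hf).symm
  · refine ContinuousAt.congr ?_ (eventuallyEq_branch f h₀).symm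
    have h1 : ContinuousAt (fun z => Complex.log (z / z₀) + Complex.log z₀) z₀ := by
      refine ContinuousAt.add (ContinuousAt.clog (by fun_prop) ?_) continuousAt_const
      rw [div_self h₀]
      exact Complex.one_mem_slitPlane
    exact (hc.comp continuous_toCylinder).continuousAt.comp' h1

theorem contDiff_pullbackLog {f : Cylinder → ℂ} (hf : IsCompactlySupportedC1 f) :
    ContDiff ℝ 1 (pullbackLog f) := by
  rw [contDiff_iff_contDiffAt]
  intro z₀
  rcases eq_or_ne z₀ 0 with rfl | h₀
  · exact (contDiffAt_const (c := (0 : ℂ))).congr_of_eventuallyEq (eventuallyEq_zero hf.2)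
  · refine ContDiffAt.congr_of_eventuallyEq ?_ (eventuallyEq_branch f h₀)
    have h1 : ContDiffAt ℝ 1 (fun z => Complex.log (z / z₀) + Complex.log z₀) z₀ := by
      have h2 : ContDiffAt ℂ 1 (fun z => Complex.log (z / z₀) + Complex.log z₀) z₀ := by
        refine ContDiffAt.add (ContDiffAt.comp z₀ (Complex.contDiffAt_log ?_)
          (contDiffAt_id.div_const _)) contDiffAt_const
        rw [div_self h₀]
        exact Complex.one_mem_slitPlane
      exact h2.restrict_scalars ℝ
    exact ContDiffAt.comp (g := fun z => f (toCylinder z)) z₀ hf.1.contDiffAt h1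

theorem IsCompactlySupportedC1.continuous {f : Cylinder → ℂ} (hf : IsCompactlySupportedC1 f) :
    Continuous f :=
  isQuotientMap_quotient_mk'.continuous_iff.mpr hf.1.continuous

theorem IsCompactlySupportedC1.neg {f : Cylinder → ℂ} (hf : IsCompactlySupportedC1 f) :
    IsCompactlySupportedC1 fun e => f (-e) := by
  refine ⟨?_, hf.2.comp_homeomorph (Homeomorph.neg Cylinder)⟩
  exact hf.1.comp contDiff_neg

theorem IsApproxLip.mono {g : ℂ → ℂ} {B ℓ ℓ' ε : ℝ} (hg : IsApproxLip g B ℓ ε) (h : ℓ ≤ ℓ') :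
    IsApproxLip g B ℓ' ε where
  continuous := hg.continuous
  lip_nonneg := hg.lip_nonneg.trans h
  err_nonneg := hg.err_nonneg
  norm_le := hg.norm_le
  norm_sub_le z w := (hg.norm_sub_le z w).trans (by gcongr)

theorem norm_pullbackLog_le {f : Cylinder → ℂ} {B : ℝ} (hB : ∀ e, ‖f e‖ ≤ B) (z : ℂ) :
    ‖pullbackLog f z‖ ≤ B := by
  rcases eq_or_ne z 0 with rfl | hz
  · rw [pullbackLog_zero, norm_zero]
    exact (norm_nonneg _).trans (hB 0)
  · rw [pullbackLog_of_ne hz]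
    exact hB _

theorem exists_isApproxLip_of_C1 {f : Cylinder → ℂ} (hf : IsCompactlySupportedC1 f) {B : ℝ}
    (hB : ∀ e, ‖f e‖ ≤ B) : ∃ ℓ, IsApproxLip (pullbackLog f) B ℓ 0 := by
  obtain ⟨ℓ, hℓ⟩ := ContDiff.lipschitzWith_of_hasCompactSupport
    (hasCompactSupport_pullbackLog hf.2) (contDiff_pullbackLog hf) one_ne_zero
  refine ⟨ℓ, (contDiff_pullbackLog hf).continuous, ℓ.2, le_rfl, norm_pullbackLog_le hB,
    fun z w => ?_⟩
  rw [zero_add]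
  exact hℓ.norm_sub_le z w

/-- Below the modulus `δ` of uniform continuity the error `ε` suffices; beyond it, slope `2 * B / δ`
exceeds the trivial bound `2 * B`. -/
theorem exists_isApproxLip {f : Cylinder → ℂ} (hc : Continuous f) (hf : HasCompactSupport f) {B : ℝ}
    (hB : ∀ e, ‖f e‖ ≤ B) {ε : ℝ} (hε : 0 < ε) : ∃ ℓ, IsApproxLip (pullbackLog f) B ℓ ε := by
  have hB0 : 0 ≤ B := (norm_nonneg _).trans (hB 0)
  have hg := continuous_pullbackLog hc hf
  have hu := (hasCompactSupport_pullbackLog hf).uniformContinuous_of_continuous hg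
  obtain ⟨δ, hδ, h⟩ := Metric.uniformContinuous_iff.mp hu ε hε
  refine ⟨2 * B / δ, hg, by positivity, hε.le, norm_pullbackLog_le hB, fun z w => ?_⟩
  rcases lt_or_ge (dist z w) δ with hd | hd
  · have := h hd
    rw [dist_eq_norm] at this
    have h2 : 0 ≤ 2 * B / δ * ‖z - w‖ := by positivity
    linarith
  · rw [dist_eq_norm] at hd
    have h1 : ‖pullbackLog f z - pullbackLog f w‖ ≤ 2 * B := by
      refine (norm_sub_le _ _).trans ?_
      linarith [norm_pullbackLog_le hB z, norm_pullbackLog_le hB w]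
    have h2 : 2 * B ≤ 2 * B / δ * ‖z - w‖ := by
      rw [div_mul_eq_mul_div, le_div_iff₀ hδ]
      gcongr
    linarith


/-! ### The limit density and its mass -/

theorem continuous_pairCorrelationFunction : Continuous pairCorrelationFunction := by
  have := continuous_cylRe
  unfold pairCorrelationFunction
  fun_prop

theorem measurableSet_strip : MeasurableSet {z : ℂ | z.im ∈ Set.Ioc (-Real.pi) Real.pi} :=
  Complex.measurable_im measurableSet_Ioc

theorem integral_lebCylinder {f : Cylinder → ℂ} (hf : Continuous f) :
    ∫ e, f e ∂lebCylinder =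
      ∫ z in {z : ℂ | z.im ∈ Set.Ioc (-Real.pi) Real.pi}, f (toCylinder z) :=
  integral_map continuous_toCylinder.measurable.aemeasurable hf.aestronglyMeasurable

/-- One square is the Jacobian of the exponential; the other factor is the weight found in
`quotientIntegral_eq`. -/
theorem exp_mul_min_pow (x : ℝ) :
    Real.exp x ^ 2 * (Real.exp x ^ 2 * min 1 (Real.exp x)⁻¹ ^ 8) = Real.exp (-4 * |x|) := by
  rw [← Real.exp_neg]
  rcases le_total 0 x with hx | hx
  · rw [min_eq_right (Real.exp_le_one_iff.mpr (by linarith)), abs_of_nonneg hx, ← Real.exp_nat_mul,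
      ← Real.exp_nat_mul, ← Real.exp_add, ← Real.exp_add]
    congr 1
    push_cast
    ring
  · rw [min_eq_left (Real.one_le_exp (by linarith)), abs_of_nonpos hx, ← Real.exp_nat_mul,
      one_pow, mul_one, ← Real.exp_add]
    congr 1
    push_cast
    ring

theorem quotientIntegral_pullbackLog {f : Cylinder → ℂ} (hc : Continuous f)
    (hf : HasCompactSupport f) {N : ℝ} (hN : 0 < N) :
    quotientIntegral N (pullbackLog f) = ((Real.pi ^ 2 / 4 * N ^ 8 : ℝ) : ℂ) *
      ∫ e, (pairCorrelationFunction e : ℂ) * f e ∂lebCylinder := by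
  obtain ⟨_, R, -, -, hR⟩ := exists_pullbackLog_eq_zero hf
  have hπ : (Real.pi : ℂ) ≠ 0 := by exact_mod_cast Real.pi_ne_zero
  have hpc : Continuous fun e => (pairCorrelationFunction e : ℂ) * f e :=
    (Complex.continuous_ofReal.comp continuous_pairCorrelationFunction).mul hc
  rw [quotientIntegral_eq (continuous_pullbackLog hc hf) hR hN, integral_eq_integral_strip,
    integral_lebCylinder hpc]
  have e : ∀ z : ℂ, ((‖Complex.exp z‖ ^ 2 : ℝ) : ℂ) *
      (((‖Complex.exp z‖ ^ 2 * min 1 ‖Complex.exp z‖⁻¹ ^ 8 : ℝ) : ℂ) *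
        pullbackLog f (Complex.exp z)) =
      (Real.pi : ℂ) * ((pairCorrelationFunction (toCylinder z) : ℂ) * f (toCylinder z)) := by
    intro z
    rw [pullbackLog_exp, Complex.norm_exp, ← mul_assoc, ← Complex.ofReal_mul, exp_mul_min_pow,
      pairCorrelationFunction, cylRe_toCylinder]
    push_cast
    field_simp
  simp_rw [e]
  rw [integral_const_mul]
  push_cast
  ring

theorem lintegral_exp_neg_abs :
    ∫⁻ x : ℝ, ENNReal.ofReal (1 / Real.pi * Real.exp (-4 * |x|)) =
      ENNReal.ofReal (1 / (2 * Real.pi)) := by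
  have hi : IntegrableOn (fun x : ℝ => Real.exp (-4 * x)) (Set.Ioi 0) :=
    integrableOn_exp_mul_Ioi (by norm_num) 0
  have h1 : ∫ x : ℝ, Real.exp (-4 * |x|) = 1 / 2 := by
    rw [integral_comp_abs (f := fun x => Real.exp (-4 * x)), integral_exp_mul_Ioi (by norm_num)]
    norm_num
  -- The integral of a nonintegrable function is `0` by convention, so the value `1 / 2` proves
  -- integrability.
  have hint : Integrable fun x : ℝ => Real.exp (-4 * |x|) := by
    by_contra h
    rw [integral_undef h] at h1
    norm_num at h1
  rw [← ofReal_integral_eq_lintegral_ofReal (hint.const_mul _) (ae_of_all _ fun x => by positivity),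
    integral_const_mul, h1]
  congr 1
  field_simp

theorem isProbabilityMeasure_limitMeasure : IsProbabilityMeasure limitMeasure := by
  refine ⟨?_⟩
  have hm : Measurable fun e => ENNReal.ofReal (pairCorrelationFunction e) :=
    continuous_pairCorrelationFunction.measurable.ennreal_ofReal
  rw [limitMeasure, withDensity_apply _ MeasurableSet.univ, Measure.restrict_univ, lebCylinder,
    lintegral_map hm continuous_toCylinder.measurable]
  rw [← lintegral_indicator measurableSet_strip,
    ← Complex.volume_preserving_equiv_real_prod.symm.lintegral_comp_emb
      (MeasurableEquiv.measurableEmbedding _)]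
  have e (p : ℝ × ℝ) : {z : ℂ | z.im ∈ Set.Ioc (-Real.pi) Real.pi}.indicator
      (fun z => ENNReal.ofReal (pairCorrelationFunction (toCylinder z)))
      (Complex.measurableEquivRealProd.symm p) =
      ENNReal.ofReal (1 / Real.pi * Real.exp (-4 * |p.1|)) *
        (Set.Ioc (-Real.pi) Real.pi).indicator 1 p.2 := by
    by_cases hp : p.2 ∈ Set.Ioc (-Real.pi) Real.pi
    · rw [Set.indicator_of_mem (by exact hp), Set.indicator_of_mem hp]
      simp [pairCorrelationFunction]
    · rw [Set.indicator_of_notMem (by exact hp), Set.indicator_of_notMem hp, mul_zero]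
  simp_rw [e]
  have hπ := Real.pi_pos
  have hprod := lintegral_prod_mul (μ := (volume : Measure ℝ)) (ν := (volume : Measure ℝ))
    (f := fun x : ℝ => ENNReal.ofReal (1 / Real.pi * Real.exp (-4 * |x|)))
    (g := (Set.Ioc (-Real.pi) Real.pi).indicator 1) (by fun_prop)
    ((measurable_one.indicator measurableSet_Ioc).aemeasurable)
  rw [Measure.volume_eq_prod, hprod, lintegral_exp_neg_abs,
    lintegral_indicator_one measurableSet_Ioc, Real.volume_Ioc, ← ENNReal.ofReal_mul (by positivity)]
  rw [← ENNReal.ofReal_one]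
  congr 1
  field_simp
  ring

theorem integral_limitMeasure (f : Cylinder → ℂ) :
    ∫ e, f e ∂limitMeasure = ∫ e, (pairCorrelationFunction e : ℂ) * f e ∂lebCylinder := by
  have hm : Measurable fun e => Real.toNNReal (pairCorrelationFunction e) :=
    continuous_pairCorrelationFunction.measurable.real_toNNReal
  have h := integral_withDensity_eq_integral_smul (μ := lebCylinder) hm f
  rw [limitMeasure]
  refine h.trans (integral_congr_ae (ae_of_all _ fun e => ?_))
  have h0 : 0 ≤ pairCorrelationFunction e := by unfold pairCorrelationFunction; positivity
  simp only [NNReal.smul_def, Real.coe_toNNReal _ h0, Complex.real_smul]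

/-! ### The pair measures as finite sums -/

section PairMeasure

variable {K : Type*} [Field K] {σ : K →+* ℂ} {Λ : Ideal (𝓞 K)} {N : ℕ}

theorem coe_offDiag_eq_pairIndex {s : Finset (𝓞 K)} [DecidableEq (𝓞 K)]
    (hs : ∀ m, m ∈ s ↔ m ∈ Λ ∧ m ≠ 0 ∧ ‖σ m‖ ≤ N) :
    pairIndex σ Λ N = (s.offDiag : Set (𝓞 K × 𝓞 K)) := by
  ext p
  have h0 (m : 𝓞 K) : 0 < ‖σ m‖ ↔ m ≠ 0 := by
    rw [norm_pos_iff, Ne, map_eq_zero_iff _ σ.injective, NumberField.RingOfIntegers.coe_eq_zero_iff]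
  simp only [pairIndex, Set.mem_ofPred_eq, Finset.coe_offDiag, Set.mem_offDiag, Finset.mem_coe, hs,
    h0]
  tauto

theorem pairMeasure_eq_sum {s : Finset (𝓞 K)} [DecidableEq (𝓞 K)]
    (hs : ∀ m, m ∈ s ↔ m ∈ Λ ∧ m ≠ 0 ∧ ‖σ m‖ ≤ N) :
    pairMeasure σ Λ N = ∑ p ∈ s.offDiag, ((eulerPhi p.1 * eulerPhi p.2 : ℕ) : ℝ≥0∞) •
      Measure.dirac (cylLog (σ p.1) - cylLog (σ p.2)) := by
  rw [pairMeasure, coe_offDiag_eq_pairIndex hs]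
  simp only [SetLike.coe_sort_coe, Measure.sum_fintype]
  exact Finset.sum_coe_sort s.offDiag fun p => ((eulerPhi p.1 * eulerPhi p.2 : ℕ) : ℝ≥0∞) •
      Measure.dirac (cylLog (σ p.1) - cylLog (σ p.2))

theorem sum_offDiag_eq {R : Type*} [AddCommGroup R] {ι : Type*} [DecidableEq ι] (s : Finset ι)
    (F : ι × ι → R) :
    ∑ p ∈ s.offDiag, F p = ∑ m ∈ s, ∑ n ∈ s, F (m, n) - ∑ m ∈ s, F (m, m) := by
  rw [← Finset.sum_product', ← Finset.diag_union_offDiag, Finset.sum_union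
    (Finset.disjoint_diag_offDiag s), Finset.sum_diag]
  abel

/-- The full double sum is the one estimated above; the diagonal to be removed sits at `log 1 = 0`.
-/
theorem integral_pairMeasure {s : Finset (𝓞 K)} (hs : ∀ m, m ∈ s ↔ m ∈ Λ ∧ m ≠ 0 ∧ ‖σ m‖ ≤ N)
    (f : Cylinder → ℂ) :
    ∫ e, f e ∂(pairMeasure σ Λ N) =
      ∑ m ∈ s, ∑ n ∈ s, (eulerPhi m : ℂ) * eulerPhi n * pullbackLog f (σ m / σ n)
        - (∑ m ∈ s, (eulerPhi m : ℂ) ^ 2) * f 0 := by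
  classical
  have hne (m) (hm : m ∈ s) : σ ((m : 𝓞 K) : K) ≠ 0 := by
    rw [Ne, map_eq_zero_iff _ σ.injective, NumberField.RingOfIntegers.coe_eq_zero_iff]
    exact ((hs m).mp hm).2.1
  rw [pairMeasure_eq_sum hs, integral_finsetSum_measure]
  · have e : ∀ p ∈ s.offDiag, ∫ e, f e ∂(((eulerPhi p.1 * eulerPhi p.2 : ℕ) : ℝ≥0∞) •
        Measure.dirac (cylLog (σ p.1) - cylLog (σ p.2))) =
        (eulerPhi p.1 : ℂ) * eulerPhi p.2 * pullbackLog f (σ p.1 / σ p.2) := by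
      intro p hp
      obtain ⟨h1, h2, -⟩ := Finset.mem_offDiag.mp hp
      rw [integral_smul_measure, integral_dirac, cylLog_sub (hne _ h1) (hne _ h2),
        pullbackLog_of_ne (div_ne_zero (hne _ h1) (hne _ h2)), ENNReal.toReal_natCast,
        Complex.real_smul]
      push_cast
      ring
    rw [Finset.sum_congr rfl e, sum_offDiag_eq]
    congr 1
    rw [Finset.sum_mul]
    refine Finset.sum_congr rfl fun m hm => ?_
    have h1 : pullbackLog f 1 = f 0 := by
      have := pullbackLog_exp f 0
      rw [Complex.exp_zero] at this
      rw [this]; rfl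
    simp only [div_self (hne m hm), h1]
    ring
  · intro p _
    exact (integrable_dirac (by simp)).smul_measure (ENNReal.natCast_ne_top _)

theorem pairMeasure_univ {s : Finset (𝓞 K)} (hs : ∀ m, m ∈ s ↔ m ∈ Λ ∧ m ≠ 0 ∧ ‖σ m‖ ≤ N) :
    pairMeasure σ Λ N Set.univ ≠ ⊤ ∧ (pairMeasure σ Λ N Set.univ).toReal =
      (∑ m ∈ s, (eulerPhi m : ℝ)) ^ 2 - ∑ m ∈ s, (eulerPhi m : ℝ) ^ 2 := by
  classical
  have e : pairMeasure σ Λ N Set.univ =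
      ((∑ p ∈ s.offDiag, eulerPhi p.1 * eulerPhi p.2 : ℕ) : ℝ≥0∞) := by
    rw [pairMeasure_eq_sum hs, Measure.finsetSum_apply]
    simp
  rw [e]
  refine ⟨ENNReal.natCast_ne_top _, ?_⟩
  rw [ENNReal.toReal_natCast, sq, Finset.sum_mul_sum]
  push_cast
  rw [sum_offDiag_eq]
  simp only [sq]

theorem integral_normalizedPairMeasure (f : Cylinder → ℂ) :
    ∫ e, f e ∂(normalizedPairMeasure σ Λ N) =
      ((pairMeasure σ Λ N Set.univ).toReal : ℂ)⁻¹ * ∫ e, f e ∂(pairMeasure σ Λ N) := by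
  rw [normalizedPairMeasure, integral_smul_measure, ENNReal.toReal_inv, Complex.real_smul]
  push_cast
  rfl

theorem isProbabilityMeasure_normalizedPairMeasure
    (h0 : 0 < (pairMeasure σ Λ N Set.univ).toReal) :
    IsProbabilityMeasure (normalizedPairMeasure σ Λ N) := by
  obtain ⟨h1, h2⟩ := ENNReal.toReal_pos_iff.mp h0
  refine ⟨?_⟩
  rw [normalizedPairMeasure, Measure.smul_apply, smul_eq_mul]
  exact ENNReal.inv_mul_cancel h1.ne' h2.ne

end PairMeasure

/-! ### Equidistribution and rate of convergence -/

theorem isApproxLip_one : IsApproxLip (fun _ => 1) 1 0 0 where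
  continuous := continuous_const
  lip_nonneg := le_rfl
  err_nonneg := le_rfl
  norm_le z := by simp
  norm_sub_le z w := by simp

theorem norm_integral_pairCorrelation_le {f : Cylinder → ℂ} {B : ℝ} (hB : ∀ e, ‖f e‖ ≤ B) :
    ‖∫ e, (pairCorrelationFunction e : ℂ) * f e ∂lebCylinder‖ ≤ B := by
  have := isProbabilityMeasure_limitMeasure
  rw [← integral_limitMeasure]
  simpa using norm_integral_le_of_norm_le_const (μ := limitMeasure) (ae_of_all _ hB)

/-- If `P` is close to `Q I`, then `P / Q` is close to `I`. -/
theorem norm_inv_mul_sub_le {P I : ℂ} {Q q X Y : ℝ} (hq : 0 < q) (hQ : q ≤ Q)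
    (hPI : ‖P - Q * I‖ ≤ X) (hX : X ≤ q * Y) : ‖(Q : ℂ)⁻¹ * P - I‖ ≤ Y := by
  have hQ0 : 0 < Q := hq.trans_le hQ
  have hQc : (Q : ℂ) ≠ 0 := by exact_mod_cast hQ0.ne'
  have hY : 0 ≤ Y := by
    by_contra h
    push Not at h
    nlinarith [norm_nonneg (P - Q * I)]
  have e : (Q : ℂ)⁻¹ * P - I = (Q : ℂ)⁻¹ * (P - Q * I) := by field_simp
  rw [e, norm_mul, norm_inv, Complex.norm_real, Real.norm_of_nonneg hQ0.le,
    inv_mul_le_iff₀ hQ0]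
  exact (hPI.trans hX).trans (by gcongr)

theorem idealConst_pos {K : Type*} [Field K] [NumberField K] {Λ : Ideal (𝓞 K)} (hΛ : Λ ≠ ⊥) : 0 < idealConst Λ := by
  refine mul_pos (by exact_mod_cast absNorm_pos hΛ) ?_
  refine finprod_induction (fun x : ℝ => 0 < x) one_pos (fun _ _ => mul_pos) fun v => ?_
  refine finprod_induction (fun x : ℝ => 0 < x) one_pos (fun _ _ => mul_pos) fun _ => ?_
  positivity

section Equidistribution

variable {K : Type*} [Field K] [NumberField K] [NumberField.IsTotallyComplex K]
  [IsPrincipalIdealRing (𝓞 K)]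

/-- The integral of `f` and the total mass both have leading coefficient `q`, which cancels in the
quotient. The constants depend on `K` and `Λ` but not on `f`, `ℓ` or `ε`, so that `ε` may be chosen
after `C`. -/
theorem exists_equidistribution_bound (h2 : Module.finrank ℚ K = 2) (σ : K →+* ℂ)
    {Λ : Ideal (𝓞 K)} (hΛ : Λ ≠ ⊥) :
    ∃ (C : ℝ) (N₁ : ℕ), 0 < C ∧ ∀ N : ℕ, N₁ ≤ N →
      IsProbabilityMeasure (normalizedPairMeasure σ Λ N) ∧
      ∀ (f : Cylinder → ℂ) (B ℓ ε : ℝ), Continuous f → HasCompactSupport f → (∀ e, ‖f e‖ ≤ B) →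
        IsApproxLip (pullbackLog f) B ℓ ε → IsApproxLip (pullbackLog fun e => f (-e)) B ℓ ε →
        ‖∫ e, f e ∂(normalizedPairMeasure σ Λ N)
          - ∫ e, (pairCorrelationFunction e : ℂ) * f e ∂lebCylinder‖
          ≤ C * ((ℓ + B) / N + ε) := by
  obtain ⟨c, C₁, hc, hC₁, hsum⟩ := exists_totient_sum_bound h2 σ hΛ
  obtain ⟨C₂, hC₂, hpair⟩ := exists_pair_sum_bound h2 σ hc hC₁ hsum
  obtain ⟨C₃, hC₃, hcard⟩ := exists_card_bound h2 σ
  have hπ := Real.pi_pos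
  set q := c ^ 2 * (Real.pi ^ 2 / 4) with hq
  have hq0 : 0 < q := by positivity
  set C₄ := C₁ * (C₁ + c * Real.pi) with hC₄
  have hC₄0 : 0 < C₄ := by positivity
  -- Beyond this threshold the error in the mass is at most half its main term, so `Q` is at least
  -- `q / 2 * N ^ 8`.
  obtain ⟨N₁, hN₁⟩ := exists_nat_ge (1 + 2 * (C₄ + C₃) / q)
  refine ⟨2 * (C₂ + C₄ + 2 * C₃) / q, N₁, by positivity, fun N hNN => ?_⟩
  have hNr : 1 + 2 * (C₄ + C₃) / q ≤ (N : ℝ) := hN₁.trans (by exact_mod_cast hNN)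
  have h0 : 0 ≤ 2 * (C₄ + C₃) / q := by positivity
  have hN1 : (1 : ℝ) ≤ N := by linarith
  have hN0 : (0 : ℝ) < N := by linarith
  obtain ⟨s, hs⟩ : ∃ s : Finset (𝓞 K), ∀ m, m ∈ s ↔ m ∈ Λ ∧ m ≠ 0 ∧ ‖σ m‖ ≤ N := by
    have hf := (finite_norm_le h2 σ N).subset (t := {m | m ∈ Λ ∧ m ≠ 0 ∧ ‖σ m‖ ≤ N})
      fun m hm => hm.2.2
    exact ⟨hf.toFinset, fun m => by simp⟩
  set Φ : ℝ := ∑ m ∈ s, (eulerPhi m : ℝ) with hΦ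
  set G : ℝ := ∑ m ∈ s, (eulerPhi m : ℝ) ^ 2 with hG
  obtain ⟨-, hQ⟩ := pairMeasure_univ (σ := σ) hs
  set Q : ℝ := (pairMeasure σ Λ N Set.univ).toReal with hQdef
  have hG0 : 0 ≤ G := Finset.sum_nonneg fun m _ => by positivity
  have hGle : G ≤ C₃ * (N : ℝ) ^ 6 := by
    have h1 : ∀ m ∈ s, (eulerPhi m : ℝ) ^ 2 ≤ (N : ℝ) ^ 4 := fun m hm => by
      have h3 : (eulerPhi m : ℝ) ≤ ‖σ m‖ ^ 2 := by
        rw [norm_sq_eq_absNorm h2 σ]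
        exact_mod_cast eulerPhi_le m ((hs m).mp hm).2.1
      have h4 : (eulerPhi m : ℝ) ≤ (N : ℝ) ^ 2 := h3.trans (by
        have := ((hs m).mp hm).2.2
        gcongr)
      calc (eulerPhi m : ℝ) ^ 2 ≤ ((N : ℝ) ^ 2) ^ 2 := by gcongr
        _ = _ := by ring
    refine (Finset.sum_le_card_nsmul s _ _ h1).trans ?_
    rw [nsmul_eq_mul]
    calc (s.card : ℝ) * (N : ℝ) ^ 4 ≤ (C₃ * (N : ℝ) ^ 2) * (N : ℝ) ^ 4 := by
          have := hcard N hN1 s fun m hm => ((hs m).mp hm).2.2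
          gcongr
      _ = _ := by ring
  have hΦb : |Φ - c * (Real.pi / 2 * (N : ℝ) ^ 4)| ≤ C₁ * (N : ℝ) ^ 3 := by
    have h := hsum _ _ _ _ isApproxLip_one N hN0 s hs
    rw [discIntegral_one hN0.le] at h
    have e : ∑ m ∈ s, (eulerPhi m : ℂ) * 1 - c * ((Real.pi / 2 * (N : ℝ) ^ 4 : ℝ) : ℂ) =
        ((Φ - c * (Real.pi / 2 * (N : ℝ) ^ 4) : ℝ) : ℂ) := by
      rw [hΦ]; push_cast; simp
    rw [e, Complex.norm_real, Real.norm_eq_abs] at h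
    simpa using h
  have hN67 : (N : ℝ) ^ 6 ≤ (N : ℝ) ^ 7 := pow_le_pow_right₀ hN1 (by norm_num)
  have hQb : |Q - q * (N : ℝ) ^ 8| ≤ C₄ * (N : ℝ) ^ 7 + C₃ * (N : ℝ) ^ 7 := by
    -- With `M = c * (π / 2) * N ^ 4` one has `q * N ^ 8 = M ^ 2`, and `Φ ^ 2 - M ^ 2` is factored
    -- as a difference of squares.
    have e : Q - q * (N : ℝ) ^ 8 = (Φ - c * (Real.pi / 2 * (N : ℝ) ^ 4)) *
        ((Φ - c * (Real.pi / 2 * (N : ℝ) ^ 4)) + c * Real.pi * (N : ℝ) ^ 4) - G := by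
      rw [hQ, hq]; ring
    rw [e]
    refine (abs_sub _ _).trans (add_le_add ?_ ?_)
    · rw [abs_mul]
      have h3 : |Φ - c * (Real.pi / 2 * (N : ℝ) ^ 4) + c * Real.pi * (N : ℝ) ^ 4| ≤
          (C₁ + c * Real.pi) * (N : ℝ) ^ 4 := by
        refine (abs_add_le _ _).trans ?_
        rw [abs_of_nonneg (show 0 ≤ c * Real.pi * (N : ℝ) ^ 4 by positivity)]
        have : C₁ * (N : ℝ) ^ 3 ≤ C₁ * (N : ℝ) ^ 4 := by
          gcongr
          norm_num
        linarith
      calc _ ≤ (C₁ * (N : ℝ) ^ 3) * ((C₁ + c * Real.pi) * (N : ℝ) ^ 4) := by gcongr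
        _ = _ := by rw [hC₄]; ring
    · rw [abs_of_nonneg hG0]
      exact hGle.trans (by gcongr)
  have hQlow : q / 2 * (N : ℝ) ^ 8 ≤ Q := by
    have h3 : C₄ * (N : ℝ) ^ 7 + C₃ * (N : ℝ) ^ 7 ≤ q / 2 * (N : ℝ) ^ 8 := by
      have h4 : 2 * (C₄ + C₃) / q ≤ (N : ℝ) := by linarith
      rw [div_le_iff₀ hq0] at h4
      have h5 : C₄ + C₃ ≤ q / 2 * N := by linarith
      calc C₄ * (N : ℝ) ^ 7 + C₃ * (N : ℝ) ^ 7 = (C₄ + C₃) * (N : ℝ) ^ 7 := by ring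
        _ ≤ (q / 2 * N) * (N : ℝ) ^ 7 := by gcongr
        _ = _ := by ring
    have := (abs_le.mp hQb).1
    linarith
  have hq2 : 0 < q / 2 * (N : ℝ) ^ 8 := by positivity
  refine ⟨isProbabilityMeasure_normalizedPairMeasure (hq2.trans_le hQlow), ?_⟩
  intro f B ℓ ε hfc hfs hfB hg hg'
  have hB0 := hg.bound_nonneg
  have hℓ := hg.lip_nonneg
  have hε := hg.err_nonneg
  set I := ∫ e, (pairCorrelationFunction e : ℂ) * f e ∂lebCylinder with hI
  have hIB : ‖I‖ ≤ B := norm_integral_pairCorrelation_le hfB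
  have hp := hpair _ _ _ _ _ hg hg' (fun u => pullbackLog_neg f u) N hN1 s hs
  rw [quotientIntegral_pullbackLog hfc hfs hN0] at hp
  rw [integral_normalizedPairMeasure]
  refine norm_inv_mul_sub_le (X := (C₂ + C₄ + 2 * C₃) * ((ℓ + B) * (N : ℝ) ^ 7 + ε * (N : ℝ) ^ 8))
    hq2 hQlow ?_ (le_of_eq ?_)
  · rw [integral_pairMeasure hs]
    set S := ∑ m ∈ s, ∑ n ∈ s, (eulerPhi m : ℂ) * eulerPhi n * pullbackLog f (σ m / σ n)
    have hGc : ∑ m ∈ s, (eulerPhi m : ℂ) ^ 2 = (G : ℂ) := by rw [hG]; push_cast; rfl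
    rw [hGc]
    have e : S - G * f 0 - Q * I =
        (S - c ^ 2 * (((Real.pi ^ 2 / 4 * (N : ℝ) ^ 8 : ℝ) : ℂ) * I)) - G * f 0
          - ((Q - q * (N : ℝ) ^ 8 : ℝ) : ℂ) * I := by
      rw [hq]; push_cast; ring
    rw [e]
    have h5 : ‖(G : ℂ) * f 0‖ ≤ C₃ * (N : ℝ) ^ 7 * B := by
      rw [norm_mul, Complex.norm_real, Real.norm_of_nonneg hG0]
      have : G ≤ C₃ * (N : ℝ) ^ 7 := hGle.trans (by gcongr)
      gcongr
      exact hfB 0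
    have h6 : ‖((Q - q * (N : ℝ) ^ 8 : ℝ) : ℂ) * I‖ ≤
        (C₄ * (N : ℝ) ^ 7 + C₃ * (N : ℝ) ^ 7) * B := by
      rw [norm_mul, Complex.norm_real, Real.norm_eq_abs]
      gcongr
    refine (norm_sub_le _ _).trans ?_
    refine (add_le_add (norm_sub_le _ _) le_rfl).trans ?_
    have h7 : 0 ≤ (C₄ + 2 * C₃) * (ℓ * (N : ℝ) ^ 7 + ε * (N : ℝ) ^ 8) := by positivity
    linear_combination hp + h5 + h6 + h7
  · field_simp

theorem integral_normalizedPairMeasure_tendsto (h2 : Module.finrank ℚ K = 2) (σ : K →+* ℂ)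
    {Λ : Ideal (𝓞 K)} (hΛ : Λ ≠ ⊥) {f : Cylinder → ℂ} (hc : Continuous f)
    (hf : HasCompactSupport f) :
    Tendsto (fun N : ℕ => ∫ z, f z ∂(normalizedPairMeasure σ Λ N)) atTop
      (𝓝 (∫ z, f z ∂limitMeasure)) := by
  obtain ⟨C, N₁, hC, h⟩ := exists_equidistribution_bound h2 σ hΛ
  obtain ⟨B, hB⟩ := hf.exists_bound_of_continuous hc
  have hc' : Continuous fun e => f (-e) := hc.comp continuous_neg
  have hf' : HasCompactSupport fun e => f (-e) := hf.comp_homeomorph (Homeomorph.neg Cylinder)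
  rw [integral_limitMeasure, Metric.tendsto_atTop]
  intro η hη
  obtain ⟨ℓ₁, h₁⟩ := exists_isApproxLip hc hf hB (ε := η / (2 * C)) (by positivity)
  obtain ⟨ℓ₂, h₂⟩ := exists_isApproxLip hc' hf' (fun e => hB (-e)) (ε := η / (2 * C)) (by positivity)
  set ℓ := max ℓ₁ ℓ₂
  obtain ⟨N₂, hN₂⟩ := exists_nat_gt (2 * C * (ℓ + B) / η)
  refine ⟨max (max N₁ N₂) 1, fun N hN => ?_⟩
  have hN1 : N₁ ≤ N := (le_max_left _ _).trans ((le_max_left _ _).trans hN)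
  have hN2 : (N₂ : ℝ) ≤ N := by exact_mod_cast (le_max_right N₁ N₂).trans ((le_max_left _ _).trans hN)
  have hN0 : (0 : ℝ) < N := by exact_mod_cast (le_max_right (max N₁ N₂) 1).trans hN
  rw [dist_eq_norm]
  refine ((h N hN1).2 f B ℓ _ hc hf hB (h₁.mono (le_max_left _ _))
    (h₂.mono (le_max_right _ _))).trans_lt ?_
  have h3 : C * ((ℓ + B) / N) < η / 2 := by
    have := hN₂.trans_le hN2
    rw [div_lt_iff₀ hη] at this
    rw [← mul_div_assoc, div_lt_iff₀ hN0]
    linarith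
  have h4 : C * (η / (2 * C)) = η / 2 := by field_simp
  rw [mul_add, h4]
  linarith

/-- The error `C * (ℓ + B) / N` fits below the first term as soon as `N ^ (2 * α)` exceeds a
constant. The second term only needs to be nonnegative. -/
theorem exists_rate (h2 : Module.finrank ℚ K = 2) (σ : K →+* ℂ)
    {Λ : Ideal (𝓞 K)} (hΛ : Λ ≠ ⊥) {f : Cylinder → ℂ} (hf : IsCompactlySupportedC1 f)
    {α : ℝ} (hα : 0 < α) :
    ∃ N₀ : ℕ, ∀ N : ℕ, N₀ ≤ N →
      ‖(∫ z, f z ∂(normalizedPairMeasure σ Λ N))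
          - ∫ z, (pairCorrelationFunction z : ℂ) * f z ∂lebCylinder‖
        ≤ idealConst Λ * supNorm f / (N : ℝ) ^ (1 - 2 * α) + expDiffSupNorm f / (N : ℝ) ^ α := by
  have hE : 0 ≤ expDiffSupNorm f := Real.iSup_nonneg fun z => norm_nonneg _
  have hS : 0 ≤ supNorm f := Real.iSup_nonneg fun z => norm_nonneg _
  have hcΛ := idealConst_pos hΛ
  -- Absorbing the constant requires `supNorm f > 0`; for `f = 0` the left side vanishes.
  by_cases hzero : ∀ e, f e = 0
  · refine ⟨0, fun N _ => ?_⟩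
    have : f = fun _ => 0 := funext hzero
    rw [this] at hE hS ⊢
    simp only [mul_zero, integral_zero, sub_zero, norm_zero]
    positivity
  push Not at hzero
  obtain ⟨e₀, he₀⟩ := hzero
  obtain ⟨B, hB⟩ := hf.2.exists_bound_of_continuous hf.continuous
  have hSpos : 0 < supNorm f := (norm_pos_iff.mpr he₀).trans_le
    (le_ciSup (f := fun e => ‖f e‖) ⟨B, by rintro _ ⟨e, rfl⟩; exact hB e⟩ e₀)
  obtain ⟨C, N₁, hC, h⟩ := exists_equidistribution_bound h2 σ hΛ
  obtain ⟨ℓ₁, h₁⟩ := exists_isApproxLip_of_C1 hf hB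
  obtain ⟨ℓ₂, h₂⟩ := exists_isApproxLip_of_C1 hf.neg (fun e => hB (-e))
  set ℓ := max ℓ₁ ℓ₂
  have hlim : Tendsto (fun N : ℕ => (N : ℝ) ^ (2 * α)) atTop atTop :=
    (tendsto_rpow_atTop (by positivity)).comp tendsto_natCast_atTop_atTop
  obtain ⟨N₂, hN₂⟩ := eventually_atTop.mp
    (hlim.eventually_ge_atTop (C * (ℓ + B) / (idealConst Λ * supNorm f)))
  refine ⟨max (max N₁ N₂) 1, fun N hN => ?_⟩
  have hN1 : N₁ ≤ N := (le_max_left _ _).trans ((le_max_left _ _).trans hN)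
  have hN2 : N₂ ≤ N := (le_max_right N₁ N₂).trans ((le_max_left _ _).trans hN)
  have hN0 : (0 : ℝ) < N := by exact_mod_cast (le_max_right (max N₁ N₂) 1).trans hN
  refine ((h N hN1).2 f B ℓ 0 hf.continuous hf.2 hB (h₁.mono (le_max_left _ _))
    (h₂.mono (le_max_right _ _))).trans ?_
  have h3 := hN₂ N hN2
  rw [div_le_iff₀ (by positivity)] at h3
  have h4 : C * ((ℓ + B) / N + 0) ≤ idealConst Λ * supNorm f / (N : ℝ) ^ (1 - 2 * α) := by
    rw [add_zero, ← mul_div_assoc, Real.rpow_sub hN0, Real.rpow_one, div_div_eq_mul_div]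
    refine div_le_div_of_nonneg_right ?_ hN0.le
    linarith
  have h5 : 0 ≤ expDiffSupNorm f / (N : ℝ) ^ α := by positivity
  linarith

end Equidistribution

end EulerPairCorrelation

end
open EulerPairCorrelation in
theorem theorem5p1 :
    (∀ (K : Type*) [Field K] [NumberField K] [NumberField.IsTotallyComplex K]
        [IsPrincipalIdealRing (𝓞 K)], Module.finrank ℚ K = 2 →
      ∀ (σ : K →+* ℂ) (Λ : Ideal (𝓞 K)), Λ ≠ ⊥ →
        (∀ᶠ N : ℕ in atTop, IsProbabilityMeasure (normalizedPairMeasure σ Λ N)) ∧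
        IsProbabilityMeasure limitMeasure ∧
        ∀ f : Cylinder → ℂ, Continuous f → HasCompactSupport f →
          Tendsto (fun N : ℕ => ∫ z, f z ∂(normalizedPairMeasure σ Λ N)) atTop
            (𝓝 (∫ z, f z ∂limitMeasure))) ∧
    (∃ C : ℝ, 0 < C ∧
      ∀ (K : Type*) [Field K] [NumberField K] [NumberField.IsTotallyComplex K]
        [IsPrincipalIdealRing (𝓞 K)], Module.finrank ℚ K = 2 →
      ∀ (σ : K →+* ℂ) (Λ : Ideal (𝓞 K)), Λ ≠ ⊥ →
      ∀ (f : Cylinder → ℂ), IsCompactlySupportedC1 f →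
      ∀ α : ℝ, 0 < α → α < 1 / 2 →
        ∃ N₀ : ℕ, ∀ N : ℕ, N₀ ≤ N →
          ‖(∫ z, f z ∂(normalizedPairMeasure σ Λ N))
              - ∫ z, (pairCorrelationFunction z : ℂ) * f z ∂lebCylinder‖
            ≤ C * (idealConst Λ * supNorm f / (N : ℝ) ^ (1 - 2 * α)
                + expDiffSupNorm f / (N : ℝ) ^ α)) := by
  -- The absolute constant can be `1`, all dependence on `K`, `Λ`, `f` and `α` being carried by
  -- `N₀`.
  refine ⟨fun K _ _ _ _ h2 σ Λ hΛ => ⟨?_, isProbabilityMeasure_limitMeasure, fun f hc hf =>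
    integral_normalizedPairMeasure_tendsto h2 σ hΛ hc hf⟩, 1, one_pos,
    fun K _ _ _ _ h2 σ Λ hΛ f hf α hα _ => ?_⟩
  · obtain ⟨_, N₁, -, h⟩ := exists_equidistribution_bound h2 σ hΛ
    exact eventually_atTop.mpr ⟨N₁, fun N hN => (h N hN).1⟩
  · simpa only [one_mul] using exists_rate h2 σ hΛ hf hα
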